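/- \textbf{Notions.} An argumentation framework $F=(A,R)$ consists of a finite non-empty set $A$ of arguments and a set $R\subseteq A\times A$ of attacks. A set $S\subseteq A$ is conflict-free if $(S\times S)\cap R=\emptyset$; it is admissible if it is conflict-free and for every $s\in S$ and every $(s',s)\in R$ there is $s''\in S$ with $(s'',s')\in R$. Let $S^+=S\cup\{a : (b,a)\in R \text{ for some } b\in S\}$. The set $S$ is preferred if it is admissible and no admissible $S'$ satisfies $S\subsetneq S'$; semi-stable if it is admissible and no admissible $S'$ satisfies $S^+\subsetneq (S')^+$; stage if it is conflict-free and no conflict-free $S'$ satisfies $S^+\subsetneq (S')^+$. For one of these semantics $\mathcal S$, the projected credulous counting problem $\#\mathrm{PCred}_{\mathcal S}$ is: given $F=(A,R)$, a set $P\subseteq A$ and an argument $a\in A$, output (in binary) the number $|\{S\cap P : S \text{ is an } \mathcal S\text{-extension of } F,\ a\in S\}|$. The underlying graph of $F$ is obtained by forgetting the directions of the attacks, and $\|F\|$ is the size of the encoding of $F$. The problem $\exists\forall\exists$-SAT is: given a closed quantified Boolean formula $\Phi=\exists X\,\forall Y\,\exists Z\;\varphi$ with $\varphi$ in conjunctive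 normal form, decide whether $\Phi$ is true. The treewidth of $\Phi$ is that of its primal graph (vertices: the variables; edges: pairs of distinct variables that occur in a common clause), and $\|\Phi\|$ is the size of the encoding of $\Phi$. A problem is solvable in time $2^{2^{2^{o(k)}}}\cdot n^{o(k)}$ if there are one algorithm and functions $f,g:\mathbb N\to\mathbb R$ with $f(k),g(k)\in o(k)$ for $k\to\infty$ such that on every instance with parameter $k$ and size $n$ the algorithm outputs the correct answer within $2^{2^{2^{f(k)}}}\cdot n^{g(k)}$ steps; algorithms are programs over finitely many registers holding binary trees of cons cells, with unit-cost nil, copy, cons, head, tail and nil-test instructions (a deterministic model polynomially equivalent to multi-tape Turing machines). The hypothesis 3ETH says that $\exists\forall\exists$-SAT cannot be decided in time $2^{2^{2^{o(k)}}}\cdot\|\Phi\|^{o(k)}$, where $k$ is the treewidth of $\Phi$. \textbf{Theorem.} Let $\mathcal S$ be the preferred, the semi-stable or the stage semantics. Unless 3ETH fails, $\#\mathrm{PCred}_{\mathcal S}$ cannot be solved in time $2^{2^{2^{o(k)}}}\cdot\|F\|^{o(k)}$, where $k$ is the treewidth of the underlying graph of the given framework $F$. -/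

import Mathlib

namespace ArgTW

/-! ### Treewidth -/

/-- A tree decomposition of `G` over the finite tree `T` with bags `bag`. (Choosing a root plays no
role for the width; `T.IsTree` includes that the tree has at least one node.) -/
structure TreeDecomposition {V : Type} (G : SimpleGraph V) (ι : Type) where
  T : SimpleGraph ι
  isTree : T.IsTree
  bag : ι → Finset V
  vertex_mem : ∀ v : V, ∃ t, v ∈ bag t
  edge_mem : ∀ u v : V, G.Adj u v → ∃ t, u ∈ bag t ∧ v ∈ bag t
  path_inter : ∀ (r t : ι) (p : T.Walk r t), p.IsPath →
    ∀ s ∈ p.support, ∀ v, v ∈ bag r → v ∈ bag t → v ∈ bag s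

/-- The width: the maximal bag size minus one. (Only the graph without vertices is affected by the
truncated subtraction; it gets treewidth `0`.) -/
def TreeDecomposition.width {V : Type} {G : SimpleGraph V} {ι : Type} [Fintype ι]
    (D : TreeDecomposition G ι) : ℕ :=
  (Finset.univ.sup fun t => (D.bag t).card) - 1

/-- The treewidth of a finite graph: the minimal width of a tree decomposition. -/
noncomputable def treewidth {V : Type} (G : SimpleGraph V) : ℕ :=
  sInf {w : ℕ | ∃ (ι : Type) (_ : Fintype ι) (D : TreeDecomposition G ι), D.width = w}

/-! ### Abstract argumentation -/

/-- An argumentation framework `F = (A, R)`: a finite non-empty set of arguments and a set of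
attacks `(a, b)` ("`a` attacks `b`") between them. -/
structure AF (α : Type) where
  args : Finset α
  nonempty : args.Nonempty
  attacks : Finset (α × α)
  attacks_sub : ∀ e ∈ attacks, e.1 ∈ args ∧ e.2 ∈ args

namespace AF

variable {α : Type}

/-- `S` is a set of arguments of `F` without attacks inside `S`. -/
def ConflictFree (F : AF α) (S : Set α) : Prop :=
  S ⊆ ↑F.args ∧ ∀ a ∈ S, ∀ b ∈ S, (a, b) ∉ F.attacks

/-- `s` is defended by `S`: every attacker of `s` is attacked by a member of `S`. -/
def Defends (F : AF α) (S : Set α) (s : α) : Prop :=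
  ∀ s', (s', s) ∈ F.attacks → ∃ s'' ∈ S, (s'', s') ∈ F.attacks

def Admissible (F : AF α) (S : Set α) : Prop :=
  F.ConflictFree S ∧ ∀ s ∈ S, F.Defends S s

/-- The range `S⁺` of `S`: the members of `S` and the arguments attacked by `S`. -/
def range (F : AF α) (S : Set α) : Set α :=
  S ∪ {a | ∃ b ∈ S, (b, a) ∈ F.attacks}

def Preferred (F : AF α) (S : Set α) : Prop :=
  F.Admissible S ∧ ¬ ∃ S', F.Admissible S' ∧ S ⊂ S'

def SemiStable (F : AF α) (S : Set α) : Prop :=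
  F.Admissible S ∧ ¬ ∃ S', F.Admissible S' ∧ F.range S ⊂ F.range S'

def Stage (F : AF α) (S : Set α) : Prop :=
  F.ConflictFree S ∧ ¬ ∃ S', F.ConflictFree S' ∧ F.range S ⊂ F.range S'

/-- The underlying undirected graph `G_F`: forget the directions of the attacks. (Self-attacks
would be loops, which do not matter for tree decompositions.) -/
def underlyingGraph (F : AF α) : SimpleGraph {a // a ∈ F.args} :=
  SimpleGraph.fromRel fun u v => (u.1, v.1) ∈ F.attacks

end AF

inductive Semantics
  | preferred
  | semiStable
  | stage

/-- `F.IsExtension σ S`: the set `S` is a `σ`-extension of `F`. -/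
def AF.IsExtension {α : Type} (F : AF α) : Semantics → Set α → Prop
  | .preferred => F.Preferred
  | .semiStable => F.SemiStable
  | .stage => F.Stage

/-- The projected credulous count `|{S ∩ P : S a σ-extension of F with a ∈ S}|`. -/
noncomputable def AF.projCredCount {α : Type} (F : AF α) (σ : Semantics) (P : Set α) (a : α) : ℕ :=
  {Q : Set α | ∃ S, F.IsExtension σ S ∧ a ∈ S ∧ Q = S ∩ P}.ncard

/-! ### Machine model

Deterministic programs over cons cells (the WHILE language over binary trees): finitely many
registers, each holding a binary tree. Every elementary instruction (`nil`, copy a pointer, `cons`,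
head, tail) and every test for `nil` takes one step. The model simulates multi-tape
Turing machines with constant overhead (a tape is a pair of lists), and a Turing machine simulates
it, storing the cells in a heap, with polynomial overhead. -/

inductive Data
  | nil
  | cons (a b : Data)

namespace Data

/-- The number of nodes of the tree; it is the size measure of encoded inputs. -/
def size : Data → ℕ
  | nil => 1
  | cons a b => a.size + b.size + 1

def head : Data → Data
  | nil => nil
  | cons a _ => a

def tail : Data → Data
  | nil => nil
  | cons _ b => b

end Data

/-- Programs; registers are numbered, and a program mentions only finitely many of them. -/
inductive Prog
  | setNil (x : ℕ)
  | copy (x y : ℕ)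
  | cons (x y z : ℕ)
  | head (x y : ℕ)
  | tail (x y : ℕ)
  | seq (p q : Prog)
  | ite (x : ℕ) (p q : Prog)
  | loop (x : ℕ) (p : Prog)

/-- The contents of the registers. -/
abbrev Store := ℕ → Data

/-- `Exec p s s' t`: started on the store `s`, the program `p` halts with the store `s'` after
exactly `t` steps. -/
inductive Exec : Prog → Store → Store → ℕ → Prop
  | setNil (x : ℕ) (s : Store) :
      Exec (.setNil x) s (Function.update s x .nil) 1
  | copy (x y : ℕ) (s : Store) :
      Exec (.copy x y) s (Function.update s x (s y)) 1
  | cons (x y z : ℕ) (s : Store) :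
      Exec (.cons x y z) s (Function.update s x (.cons (s y) (s z))) 1
  | head (x y : ℕ) (s : Store) :
      Exec (.head x y) s (Function.update s x (s y).head) 1
  | tail (x y : ℕ) (s : Store) :
      Exec (.tail x y) s (Function.update s x (s y).tail) 1
  | seq {p q : Prog} {s s' s'' : Store} {t t' : ℕ} :
      Exec p s s' t → Exec q s' s'' t' → Exec (.seq p q) s s'' (t + t')
  | iteTrue {x : ℕ} {p q : Prog} {s s' : Store} {t : ℕ} :
      s x ≠ .nil → Exec p s s' t → Exec (.ite x p q) s s' (t + 1)
  | iteFalse {x : ℕ} {p q : Prog} {s s' : Store} {t : ℕ} :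
      s x = .nil → Exec q s s' t → Exec (.ite x p q) s s' (t + 1)
  | loopDone {x : ℕ} {p : Prog} {s : Store} :
      s x = .nil → Exec (.loop x p) s s 1
  | loopStep {x : ℕ} {p : Prog} {s s' s'' : Store} {t t' : ℕ} :
      s x ≠ .nil → Exec p s s' t → Exec (.loop x p) s' s'' t' →
        Exec (.loop x p) s s'' (t + t' + 1)

/-- On input `i` (in register `0`, all other registers `nil`) the program halts after exactly `t`
steps with output `o` in register `0`. -/
def Prog.Outputs (p : Prog) (i o : Data) (t : ℕ) : Prop :=
  ∃ s' : Store, Exec p (Function.update (fun _ => Data.nil) 0 i) s' t ∧ s' 0 = o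

/-- The problem "given an instance `x`, encoded as `inp x`, output `out x`" is solvable in time
`2^(2^(2^o(k))) · n^o(k)` with `k = param x` and `n = size x`. -/
def SolvableInTripleExpTime {I : Type} (inp out : I → Data) (param size : I → ℕ) : Prop :=
  ∃ (p : Prog) (f g : ℕ → ℝ),
    Asymptotics.IsLittleO Filter.atTop f (fun k : ℕ => (k : ℝ)) ∧
    Asymptotics.IsLittleO Filter.atTop g (fun k : ℕ => (k : ℝ)) ∧
    ∀ x : I, ∃ t : ℕ, p.Outputs (inp x) (out x) t ∧
      (t : ℝ) ≤ (2 : ℝ) ^ ((2 : ℝ) ^ ((2 : ℝ) ^ f (param x))) * (size x : ℝ) ^ g (param x)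

/-! ### Encodings -/

def encBool : Bool → Data
  | false => .nil
  | true => .cons .nil .nil

def encList {β : Type} (e : β → Data) : List β → Data
  | [] => .nil
  | b :: l => .cons (e b) (encList e l)

def encPair {β γ : Type} (e : β → Data) (e' : γ → Data) (x : β × γ) : Data :=
  .cons (e x.1) (e' x.2)

/-- Natural numbers in binary, least significant bit first. -/
def encNat (n : ℕ) : Data :=
  encList encBool n.bits

/-! ### Projected credulous counting -/

/-- An input of the projected credulous counting problem: a framework, given by lists of its
arguments and attacks, projection arguments, and a credulous argument. Arguments are named by
natural numbers. -/
structure PCredInput where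
  args : List ℕ
  attacks : List (ℕ × ℕ)
  proj : List ℕ
  query : ℕ
  args_nodup : args.Nodup
  attacks_nodup : attacks.Nodup
  proj_nodup : proj.Nodup
  attacks_sub : ∀ e ∈ attacks, e.1 ∈ args ∧ e.2 ∈ args
  proj_sub : ∀ a ∈ proj, a ∈ args
  query_mem : query ∈ args

namespace PCredInput

def framework (I : PCredInput) : AF ℕ where
  args := I.args.toFinset
  nonempty := ⟨I.query, List.mem_toFinset.2 I.query_mem⟩
  attacks := I.attacks.toFinset
  attacks_sub := fun e he => by
    have h := I.attacks_sub e (List.mem_toFinset.1 he)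
    exact ⟨List.mem_toFinset.2 h.1, List.mem_toFinset.2 h.2⟩

def encFramework (I : PCredInput) : Data :=
  .cons (encList encNat I.args) (encList (encPair encNat encNat) I.attacks)

def enc (I : PCredInput) : Data :=
  .cons I.encFramework (.cons (encList encNat I.proj) (encNat I.query))

/-- `‖F‖`, the size of the encoded framework. -/
def frameworkSize (I : PCredInput) : ℕ :=
  I.encFramework.size

noncomputable def tw (I : PCredInput) : ℕ :=
  treewidth I.framework.underlyingGraph

noncomputable def count (I : PCredInput) (σ : Semantics) : ℕ :=
  I.framework.projCredCount σ {a | a ∈ I.proj} I.query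

end PCredInput

/-- `#PCred_σ` can be solved in time `2^(2^(2^o(k))) · ‖F‖^o(k)`, where `k` is the treewidth of the
underlying graph of the framework `F`. -/
def PCredSolvableInTripleExpTime (σ : Semantics) : Prop :=
  SolvableInTripleExpTime PCredInput.enc (fun I => encNat (I.count σ))
    PCredInput.tw PCredInput.frameworkSize

/-! ### Quantified Boolean formulas and the hypothesis 3ETH -/

/-- A closed formula `∃ X ∀ Y ∃ Z φ` with `φ` in conjunctive normal form. A literal `(v, b)` is the
variable `v` if `b = true` and its negation if `b = false`. -/
structure QBF where
  X : List ℕ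
  Y : List ℕ
  Z : List ℕ
  clauses : List (List (ℕ × Bool))
  vars_nodup : (X ++ Y ++ Z).Nodup
  clauses_nodup : ∀ C ∈ clauses, C.Nodup
  closed : ∀ C ∈ clauses, ∀ l ∈ C, l.1 ∈ X ++ Y ++ Z

namespace QBF

def vars (Φ : QBF) : List ℕ := Φ.X ++ Φ.Y ++ Φ.Z

/-- The assignment `τ` satisfies the matrix. -/
def Sat (Φ : QBF) (τ : ℕ → Bool) : Prop :=
  ∀ C ∈ Φ.clauses, ∃ l ∈ C, τ l.1 = l.2

def IsTrue (Φ : QBF) : Prop :=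
  ∃ x : ℕ → Bool, ∀ y : ℕ → Bool, ∃ z : ℕ → Bool,
    Φ.Sat fun v => if v ∈ Φ.X then x v else if v ∈ Φ.Y then y v else z v

/-- The primal graph: the vertices are the variables, and two distinct variables are adjacent if
they occur in a common clause. -/
def primalGraph (Φ : QBF) : SimpleGraph {v // v ∈ Φ.vars} where
  Adj u v := u ≠ v ∧ ∃ C ∈ Φ.clauses, (∃ b, (u.1, b) ∈ C) ∧ ∃ b, (v.1, b) ∈ C
  symm := ⟨fun _ _ h => ⟨h.1.symm, h.2.imp fun _ hC => ⟨hC.1, hC.2.2, hC.2.1⟩⟩⟩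
  loopless := ⟨fun _ h => h.1 rfl⟩

noncomputable def tw (Φ : QBF) : ℕ :=
  treewidth Φ.primalGraph

def enc (Φ : QBF) : Data :=
  .cons (encList encNat Φ.X) (.cons (encList encNat Φ.Y) (.cons (encList encNat Φ.Z)
    (encList (encList (encPair encNat encBool)) Φ.clauses)))

/-- `‖Φ‖`, the size of the encoded formula. -/
def size (Φ : QBF) : ℕ :=
  Φ.enc.size

end QBF

/-- 3ETH: truth of formulas `Φ = ∃ X ∀ Y ∃ Z φ` cannot be decided in time
`2^(2^(2^o(k))) · ‖Φ‖^o(k)`, where `k` is the treewidth of (the primal graph of) `Φ`. -/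
def ThreeETH : Prop :=
  ¬ SolvableInTripleExpTime QBF.enc (fun Φ => encBool (open Classical in decide Φ.IsTrue))
    QBF.tw QBF.size

end ArgTW

/-! ### Polynomial-time programs over cons cells. -/

namespace ArgTW

/-! ### Polynomially bounded functions -/

/-! The proof is a polynomial-time reduction from `∃∀∃`-SAT that increases the treewidth only
linearly. Three quantifier blocks are simulated by one number: maximality of extensions deals with
the innermost block, projecting away the universal variables deals with the middle one, and
comparing the count with its largest possible value deals with the outer one.

Add a fresh universal variable `none` and put its positive literal into every clause. In the
framework, opposite literals attack each other, a literal attacks the clauses that contain it, the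
clauses attack `phi`, `phi` attacks the self-attacking `beta`, and `beta` attacks the literals of
the innermost block, so that admissible sets can use these only together with `phi`. Each outer
literal also attacks a self-attacking marker `dl`; the markers make sets with different outer
assignments incomparable in range. For all three semantics every extension contains `top` and fixes
an assignment of the outer variables. If no choice of the inner variables satisfies the clauses,
some extension with this outer assignment avoids `phi` (`Encodes.exists_extension_of_refuted`);
conversely, an extension that avoids `phi` shows that there is no such choice
(`Encodes.refuted_of_phi_notMem`).

Project to `phi` and the literals of `X`. Each assignment of `X` contributes its projection with
`phi`, since the fresh variable can be made true, and contributes the one without `phi` exactly if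
some assignment of `Y` refutes the matrix. Hence the count reaches `2 ^ (|X| + 1)` exactly if the
formula is false (`QBF.isTrue_iff_count_lt`), which a program can check on the binary digits.

For the treewidth, replace each variable in a bag by its literals and markers, add the fresh
variable and the constants to all bags, and hang a leaf for each clause at a bag containing all its
variables; such a bag exists by the Helly property of subtrees. This gives width at most `4 * k +
11` (`QBF.tw_toInput_le`). Replacing `k` by `4 * k + 11` and the size by a polynomial preserves the
form of the time bound (`exists_isLittleO_bound`, `tripleExp_bound`). Because the machine model is
concrete, the reduction and the final test are built from combinators for polynomial-time programs.
-/

def PolyBounded (T : ℕ → ℕ) : Prop := ∃ c, ∀ n, T n ≤ (n + 2) ^ c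

namespace PolyBounded

theorem pow (c : ℕ) : PolyBounded fun n => (n + 2) ^ c := ⟨c, fun _ => le_rfl⟩

theorem id : PolyBounded fun n => n := ⟨1, fun n => by simp⟩

theorem const (k : ℕ) : PolyBounded fun _ => k :=
  ⟨k, fun n => Nat.lt_two_pow_self.le.trans (Nat.pow_le_pow_left (by omega) k)⟩

theorem add {S T : ℕ → ℕ} (hS : PolyBounded S) (hT : PolyBounded T) :
    PolyBounded fun n => S n + T n := by
  obtain ⟨a, ha⟩ := hS
  obtain ⟨b, hb⟩ := hT
  refine ⟨max a b + 1, fun n => ?_⟩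
  have h1 := (ha n).trans (Nat.pow_le_pow_right (by omega) (le_max_left a b))
  have h2 := (hb n).trans (Nat.pow_le_pow_right (by omega) (le_max_right a b))
  have h3 : (n + 2) ^ max a b * 2 ≤ (n + 2) ^ max a b * (n + 2) :=
    Nat.mul_le_mul_left _ (by omega)
  rw [pow_succ]
  dsimp only
  omega

theorem mul {S T : ℕ → ℕ} (hS : PolyBounded S) (hT : PolyBounded T) :
    PolyBounded fun n => S n * T n := by
  obtain ⟨a, ha⟩ := hS
  obtain ⟨b, hb⟩ := hT
  exact ⟨a + b, fun n => (Nat.mul_le_mul (ha n) (hb n)).trans (pow_add _ _ _).ge⟩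

theorem comp_pow {S : ℕ → ℕ} (c : ℕ) (hS : PolyBounded S) :
    PolyBounded fun n => (S n + 2) ^ c := by
  obtain ⟨a, ha⟩ := hS.add (const 2)
  exact ⟨a * c, fun n => (Nat.pow_le_pow_left (ha n) c).trans (pow_mul _ _ _).ge⟩

end PolyBounded

/-! ### Encoded types -/

/-- The instances unfold to the encodings in the statement, so that facts about programs apply to
`QBF.enc` and `PCredInput.enc` without conversion. -/
class Coded (α : Type) where
  code : α → Data

open Coded

theorem Data.size_pos (d : Data) : 0 < d.size := by cases d <;> simp [Data.size]

instance : Coded Bool := ⟨encBool⟩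
instance : Coded ℕ := ⟨encNat⟩

section
variable {α β γ δ : Type} [Coded α] [Coded β] [Coded γ] [Coded δ]

instance : Coded (α × β) := ⟨encPair code code⟩
instance : Coded (List α) := ⟨encList code⟩

/-- The size of the encoding of `a`. -/
def codeSize (a : α) : ℕ := (code a).size

theorem codeSize_pos (a : α) : 0 < codeSize a := Data.size_pos _

theorem codeSize_pair (a : α) (b : β) : codeSize (a, b) = codeSize a + codeSize b + 1 := rfl

@[simp] theorem codeSize_nil : codeSize ([] : List α) = 1 := rfl

theorem codeSize_cons (a : α) (l : List α) :
    codeSize (a :: l) = codeSize a + codeSize l + 1 := rfl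

theorem codeSize_append (l l' : List α) :
    codeSize (l ++ l') + 1 = codeSize l + codeSize l' := by
  induction l with
  | nil => simp; omega
  | cons a l ih => simp only [List.cons_append, codeSize_cons]; omega

theorem length_lt_codeSize (l : List α) : l.length < codeSize l := by
  induction l with
  | nil => simp
  | cons a l ih => simp only [List.length_cons, codeSize_cons]; omega

theorem codeSize_lt_of_mem {l : List α} {a : α} (h : a ∈ l) : codeSize a < codeSize l := by
  induction l with
  | nil => simp at h
  | cons b l ih =>
    rw [codeSize_cons]
    rcases List.mem_cons.1 h with rfl | h
    · omega
    · have := ih h; omega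

theorem codeSize_le_of_forall {l : List α} {M : ℕ} (h : ∀ a ∈ l, codeSize a ≤ M) :
    codeSize l ≤ l.length * (M + 1) + 1 := by
  induction l with
  | nil => simp
  | cons a l ih =>
    have h1 := h a (by simp)
    have h2 := ih fun b hb => h b (by simp [hb])
    rw [codeSize_cons, List.length_cons, Nat.add_mul]
    omega

omit [Coded α] in
theorem codeSize_flatMap_le {l : List α} {f : α → List β} {M : ℕ}
    (h : ∀ a ∈ l, codeSize (f a) ≤ M) : codeSize (l.flatMap f) ≤ l.length * M + 1 := by
  induction l with
  | nil => simp
  | cons a l ih =>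
    have h1 := h a (by simp)
    have h2 := ih fun b hb => h b (by simp [hb])
    have h3 := codeSize_append (f a) (l.flatMap f)
    rw [List.flatMap_cons, List.length_cons, Nat.add_mul]
    omega

/-! ### Polynomial-time computable functions -/

/-- `p` computes `f` in register `n` in time `T`; it leaves the registers below `n` alone and may
write to the registers above `n`, whose contents it does not rely on. -/
def Computes (p : Prog) (n : ℕ) (f : α → β) (T : ℕ → ℕ) : Prop :=
  ∀ (s : Store) (a : α), s n = code a → ∃ s' t, Exec p s s' t ∧ s' n = code (f a) ∧
    (∀ m < n, s' m = s m) ∧ t ≤ T (codeSize a)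

/-- The size bound is needed to estimate the time of a second program run on the output of the
first. Programs exist for every register `n`, with one exponent `c`, so that subroutines can be
placed above the registers in use. -/
def PolyTime (f : α → β) : Prop :=
  ∃ c : ℕ, (∀ a, codeSize (f a) ≤ (codeSize a + 2) ^ c) ∧
    ∀ n, ∃ p, Computes p n f fun k => (k + 2) ^ c

theorem PolyTime.of_bounds {f : α → β} {S T : ℕ → ℕ} (hS : PolyBounded S) (hT : PolyBounded T)
    (hf : ∀ a, codeSize (f a) ≤ S (codeSize a)) (hp : ∀ n, ∃ p, Computes p n f T) :
    PolyTime f := by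
  obtain ⟨c, hc⟩ := hS.add hT
  refine ⟨c, fun a => (hf a).trans ((Nat.le_add_right _ _).trans (hc _)), fun n => ?_⟩
  obtain ⟨p, hp⟩ := hp n
  refine ⟨p, fun s a h => ?_⟩
  obtain ⟨s', t, h1, h2, h3, h4⟩ := hp s a h
  exact ⟨s', t, h1, h2, h3, h4.trans ((Nat.le_add_left _ _).trans (hc _))⟩

/-- Functions computed by one instruction. -/
theorem PolyTime.of_instr {f : α → β} (I : ℕ → Prog) (F : Data → Data) (k : ℕ)
    (hI : ∀ n s, Exec (I n) s (Function.update s n (F (s n))) 1)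
    (hF : ∀ a, F (code a) = code (f a)) (hk : ∀ a, codeSize (f a) ≤ codeSize a + k) :
    PolyTime f := by
  refine .of_bounds (PolyBounded.id.add (.const k)) (.const 1) hk fun n => ⟨I n, fun s a h => ?_⟩
  refine ⟨_, _, hI n s, by simp [h, hF], fun m hm => ?_, le_rfl⟩
  rw [Function.update_of_ne hm.ne]

namespace PolyTime

/-- A function that leaves the codes unchanged. -/
theorem of_code_eq {f : α → β} (h : ∀ a, code (f a) = code a) : PolyTime f :=
  .of_instr (fun n => .copy n n) (fun d => d) 0 (fun n s => .copy n n s) (fun a => (h a).symm)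
    fun a => by simp [codeSize, h]

theorem id : PolyTime (fun a : α => a) := of_code_eq fun _ => rfl

theorem fst : PolyTime (fun p : α × β => p.1) :=
  .of_instr (fun n => .head n n) Data.head 0 (fun n s => .head n n s) (fun _ => rfl)
    fun a => by rw [show a = (a.1, a.2) from rfl, codeSize_pair]; dsimp only; omega

theorem snd : PolyTime (fun p : α × β => p.2) :=
  .of_instr (fun n => .tail n n) Data.tail 0 (fun n s => .tail n n s) (fun _ => rfl)
    fun a => by rw [show a = (a.1, a.2) from rfl, codeSize_pair]; dsimp only; omega

theorem listTail : PolyTime (fun l : List α => l.tail) :=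
  .of_instr (fun n => .tail n n) Data.tail 0 (fun n s => .tail n n s)
    (fun l => by cases l <;> rfl)
    fun l => by
      cases l with
      | nil => simp
      | cons a l => rw [codeSize_cons]; simp only [List.tail_cons]; omega

theorem comp {g : β → γ} {f : α → β} (hg : PolyTime g) (hf : PolyTime f) :
    PolyTime fun a => g (f a) := by
  obtain ⟨a, ha, pa⟩ := hf
  obtain ⟨b, hb, pb⟩ := hg
  have hab := PolyBounded.comp_pow b (.pow a)
  refine .of_bounds hab ((PolyBounded.pow a).add hab) (fun x => (hb _).trans ?_) fun n => ?_
  · exact Nat.pow_le_pow_left (by have := ha x; omega) b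
  · obtain ⟨p, hp⟩ := pa n
    obtain ⟨q, hq⟩ := pb n
    refine ⟨.seq p q, fun s x hx => ?_⟩
    obtain ⟨s₁, t₁, e₁, r₁, k₁, l₁⟩ := hp s x hx
    obtain ⟨s₂, t₂, e₂, r₂, k₂, l₂⟩ := hq s₁ _ r₁
    refine ⟨s₂, _, .seq e₁ e₂, r₂, fun m hm => (k₂ m hm).trans (k₁ m hm), ?_⟩
    exact Nat.add_le_add l₁ (l₂.trans (Nat.pow_le_pow_left (by have := ha x; omega) b))

theorem const_of_data {f : α → β} (d : Data) (h : ∀ a, code (f a) = d) : PolyTime f := by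
  -- The time `k` is chosen before `n`, since `PolyTime` asks for a bound that is uniform in the
  -- register.
  suffices H : ∃ k, ∀ n, ∃ p, ∀ s : Store, ∃ s', Exec p s s' k ∧ s' n = d ∧
      ∀ m < n, s' m = s m by
    obtain ⟨k, H⟩ := H
    refine .of_bounds (.const d.size) (.const k) (fun a => by simp [codeSize, h]) fun n => ?_
    obtain ⟨p, hp⟩ := H n
    refine ⟨p, fun s a _ => ?_⟩
    obtain ⟨s', h1, h2, h3⟩ := hp s
    exact ⟨s', k, h1, by rw [h2, h], h3, le_rfl⟩
  clear h
  induction d with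
  | nil =>
    refine ⟨1, fun n => ⟨.setNil n, fun s => ⟨_, .setNil n s, by simp, fun m hm => ?_⟩⟩⟩
    rw [Function.update_of_ne hm.ne]
  | cons d e hd he =>
    obtain ⟨k, hd⟩ := hd
    obtain ⟨l, he⟩ := he
    refine ⟨k + (l + 1), fun n => ?_⟩
    obtain ⟨p, hp⟩ := hd n
    obtain ⟨q, hq⟩ := he (n + 1)
    refine ⟨.seq p (.seq q (.cons n n (n + 1))), fun s => ?_⟩
    obtain ⟨s₁, e₁, r₁, k₁⟩ := hp s
    obtain ⟨s₂, e₂, r₂, k₂⟩ := hq s₁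
    refine ⟨_, .seq e₁ (.seq e₂ (.cons n n (n + 1) s₂)), ?_, fun m hm => ?_⟩
    · simp [r₂, k₂ n (by omega), r₁]
    · rw [Function.update_of_ne hm.ne, k₂ m (by omega), k₁ m hm]

theorem const (b : β) : PolyTime (fun _ : α => b) := const_of_data (code b) fun _ => rfl

/-- Evaluate `f` and `g` and combine the results by a `cons` instruction. -/
theorem of_cons {f : α → β} {g : α → γ} {h : α → δ} (hf : PolyTime f) (hg : PolyTime g)
    (hh : ∀ a, code (h a) = .cons (code (f a)) (code (g a))) : PolyTime h := by
  obtain ⟨a, ha, pa⟩ := hf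
  obtain ⟨b, hb, pb⟩ := hg
  have hab := (PolyBounded.pow a).add (.pow b)
  refine .of_bounds (hab.add (.const 1)) (hab.add (.const 3)) (fun x => ?_) fun n => ?_
  · have h1 := ha x
    have h2 := hb x
    have h3 : codeSize (h x) = codeSize (f x) + codeSize (g x) + 1 := by
      simp only [codeSize, hh, Data.size]
    omega
  · obtain ⟨p, hp⟩ := pa (n + 1)
    obtain ⟨q, hq⟩ := pb (n + 2)
    -- The input stays in register `n` and the first result in `n + 1`, because each program
    -- preserves the registers below its own.
    refine ⟨.seq (.copy (n + 1) n) (.seq p (.seq (.copy (n + 2) n) (.seq q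
      (.cons n (n + 1) (n + 2))))), fun s x hx => ?_⟩
    obtain ⟨s₁, t₁, e₁, r₁, k₁, l₁⟩ := hp (Function.update s (n + 1) (s n)) x (by simp [hx])
    obtain ⟨s₂, t₂, e₂, r₂, k₂, l₂⟩ := hq (Function.update s₁ (n + 2) (s₁ n)) x
      (by simp [hx, k₁ n])
    refine ⟨_, _, .seq (.copy _ _ s) (.seq e₁ (.seq (.copy _ _ s₁) (.seq e₂ (.cons _ _ _ s₂)))),
      ?_, fun m hm => ?_, ?_⟩
    · simp [r₂, k₂ (n + 1), r₁, hh]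
    · rw [Function.update_of_ne (by omega), k₂ m (by omega), Function.update_of_ne (by omega),
        k₁ m (by omega), Function.update_of_ne (by omega)]
    · dsimp only at l₁ l₂ ⊢
      omega

theorem pair {f : α → β} {g : α → γ} (hf : PolyTime f) (hg : PolyTime g) :
    PolyTime fun a => (f a, g a) := of_cons hf hg fun _ => rfl

theorem cons {f : α → β} {g : α → List β} (hf : PolyTime f) (hg : PolyTime g) :
    PolyTime fun a => f a :: g a := of_cons hf hg fun _ => rfl

theorem isEmpty : PolyTime (fun l : List α => l.isEmpty) := by
  refine .of_bounds (.const 3) (.const 4) (fun l => by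
    cases l <;> simp [codeSize, code, encBool, Data.size]) fun n =>
    -- When `cons n n n` runs, register `n` holds `nil`; the result is the code of `true`.
    ⟨.seq (.copy (n + 1) n) (.seq (.setNil n) (.ite (n + 1) (.setNil n) (.cons n n n))),
      fun s l hl => ?_⟩
  have keep : ∀ d e f, ∀ m < n, Function.update (Function.update (Function.update s (n + 1) d)
      n e) n f m = s m := fun d e f m hm => by
    rw [Function.update_of_ne (by omega), Function.update_of_ne (by omega),
      Function.update_of_ne (by omega)]
  cases l with
  | nil =>
    refine ⟨_, _, .seq (.copy _ _ s) (.seq (.setNil _ _) (.iteFalse ?_ (.cons _ _ _ _))), ?_,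
      keep _ _ _, by simp⟩
    · simp [hl, code, encList]
    · simp [code, encBool]
  | cons a l =>
    refine ⟨_, _, .seq (.copy _ _ s) (.seq (.setNil _ _) (.iteTrue ?_ (.setNil _ _))), ?_,
      keep _ _ _, by simp⟩
    · simp [hl, code, encList]
    · simp [code, encBool]

/-! ### Iteration -/

/-- The body of a loop over the list in register `n` with the accumulator in register `n + 1`. -/
def foldBody (p : Prog) (n : ℕ) : Prog :=
  .seq (.head (n + 2) n) (.seq (.cons (n + 1) (n + 1) (n + 2)) (.seq p (.tail n n)))

/-- `M` bounds all intermediate accumulators and `N` all list entries, so each input of `p` has size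
at most `M + N + 1`. Besides `p`, a round costs three instructions and one test; the last summand
`1` is the final test. -/
theorem exec_foldLoop {step : β × α → β} {p : Prog} {n : ℕ} {T : ℕ → ℕ} (hT : Monotone T)
    (hp : Computes p (n + 1) step T) {M N : ℕ} (l : List α) (b : β) (s : Store)
    (hl : s n = code l) (hb : s (n + 1) = code b)
    (hM : ∀ l', l' <+: l → codeSize (l'.foldl (fun b a => step (b, a)) b) ≤ M)
    (hN : ∀ a ∈ l, codeSize a ≤ N) :
    ∃ s' t, Exec (.loop n (foldBody p n)) s s' t ∧
      s' (n + 1) = code (l.foldl (fun b a => step (b, a)) b) ∧ (∀ m < n, s' m = s m) ∧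
      t ≤ l.length * (T (M + N + 1) + 4) + 1 := by
  induction l generalizing b s with
  | nil => exact ⟨s, 1, .loopDone hl, hb, fun _ _ => rfl, by simp⟩
  | cons a l ih =>
    set s₁ := Function.update s (n + 2) (s n).head with hs₁
    set s₂ := Function.update s₁ (n + 1) (.cons (s₁ (n + 1)) (s₁ (n + 2))) with hs₂
    obtain ⟨s₃, t₃, e₃, r₃, k₃, l₃⟩ := hp s₂ (b, a) (by
      simp [hs₂, hs₁, hl, hb, code, encPair, encList, Data.head])
    obtain ⟨s₄, t₄, e₄, r₄, k₄, l₄⟩ := ih (step (b, a)) (Function.update s₃ n (s₃ n).tail)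
      (by simp [k₃ n, hs₂, hs₁, hl, code, encList, Data.tail]) (by simp [r₃])
      (fun l' hl' => hM (a :: l') (by simpa using hl')) fun x hx => hN x (by simp [hx])
    refine ⟨s₄, _, .loopStep ?_ (.seq (.head _ _ s) (.seq (.cons _ _ _ s₁) (.seq e₃
      (.tail _ _ s₃)))) e₄, r₄, fun m hm => ?_, ?_⟩
    · simp [hl, code, encList]
    · rw [k₄ m hm, Function.update_of_ne (by omega), k₃ m (by omega), hs₂,
        Function.update_of_ne (by omega), hs₁, Function.update_of_ne (by omega)]
    · have h1 := hM [] (by simp)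
      have h2 := hN a (by simp)
      have h3 : T (codeSize (b, a)) ≤ T (M + N + 1) := hT (by
        rw [codeSize_pair]; simp only [List.foldl_nil] at h1; omega)
      rw [List.length_cons, Nat.add_mul]
      omega

theorem codeSize_le_of_prefix {l l' : List α} (h : l' <+: l) : codeSize l' ≤ codeSize l := by
  obtain ⟨r, rfl⟩ := h
  have := codeSize_append l' r
  have := codeSize_pos r
  omega

/-- Iterating a polynomial-time step can make the accumulator grow exponentially, so a size bound on
the result is assumed. Applied to the prefixes of the list, it bounds all intermediate accumulators.
-/
theorem foldl {step : β × α → β} (hs : PolyTime step) {S : ℕ → ℕ} (hS : PolyBounded S)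
    (hb : ∀ (b : β) (l : List α), codeSize (l.foldl (fun b a => step (b, a)) b) ≤ S (codeSize (b, l))) :
    PolyTime fun p : β × List α => p.2.foldl (fun b a => step (b, a)) p.1 := by
  obtain ⟨d, hd⟩ := hS
  replace hb := fun (b : β) (l : List α) => (hb b l).trans (hd _)
  obtain ⟨c, -, pc⟩ := hs
  refine .of_bounds (.pow d) (T := fun n => n * (((n + 2) ^ d + n + 1 + 2) ^ c + 4) + 4)
    ((PolyBounded.id.mul ((PolyBounded.comp_pow c (((PolyBounded.pow d).add .id).add
      (.const 1))).add (.const 4))).add (.const 4)) (fun x => hb x.1 x.2) fun n => ?_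
  obtain ⟨p, hp⟩ := pc (n + 1)
  refine ⟨.seq (.head (n + 1) n) (.seq (.tail n n) (.seq (.loop n (foldBody p n))
    (.copy n (n + 1)))), ?_⟩
  rintro s ⟨b, l⟩ h
  obtain ⟨s', t, e, r, k, ht⟩ := exec_foldLoop (M := (codeSize (b, l) + 2) ^ d)
    (N := codeSize (b, l)) (fun i j hij => Nat.pow_le_pow_left (by omega) c) hp l b
    (Function.update (Function.update s (n + 1) (s n).head) n (s n).tail)
    (by simp [h, code, encPair, Data.tail]) (by simp [h, code, encPair, Data.head])
    (fun l' hl' => (hb b l').trans (Nat.pow_le_pow_left (by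
      have := codeSize_le_of_prefix hl'
      simp only [codeSize_pair]; omega) d))
    (fun a ha => by have := codeSize_lt_of_mem ha; rw [codeSize_pair]; omega)
  have h2 : (Function.update (Function.update s (n + 1) (s n).head) n (s n).tail) =
      (Function.update (Function.update s (n + 1) (s n).head) n
        ((Function.update s (n + 1) (s n).head) n).tail) := by simp
  rw [h2] at e
  refine ⟨_, _, .seq (.head _ _ s) (.seq (.tail _ _ _) (.seq e (.copy _ _ s'))), by simp [r],
    fun m hm => ?_, ?_⟩
  · rw [Function.update_of_ne (by omega), k m hm, Function.update_of_ne (by omega),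
      Function.update_of_ne (by omega)]
  · have h3 : l.length ≤ codeSize (b, l) := by
      have := length_lt_codeSize l
      rw [codeSize_pair]; omega
    have h4 := Nat.mul_le_mul_right
      (((codeSize (b, l) + 2) ^ d + codeSize (b, l) + 1 + 2) ^ c + 4) h3
    dsimp only at ht ⊢
    omega

omit [Coded α] in
theorem foldl_cons_eq (l b : List α) : l.foldl (fun b a => a :: b) b = l.reverse ++ b := by
  induction l generalizing b with
  | nil => rfl
  | cons a l ih => simp [ih]

theorem codeSize_reverse (l : List α) : codeSize l.reverse = codeSize l := by
  induction l with
  | nil => rfl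
  | cons a l ih =>
    have h := codeSize_append l.reverse [a]
    rw [List.reverse_cons, codeSize_cons]
    rw [codeSize_cons, codeSize_nil] at h
    omega

theorem reverseAppend : PolyTime fun p : List α × List α => p.2.reverse ++ p.1 := by
  have h := foldl (α := α) (β := List α) (step := fun p => p.2 :: p.1) (snd.cons fst)
    PolyBounded.id (fun b l => by
      have := codeSize_append l.reverse b
      rw [foldl_cons_eq, codeSize_pair]
      rw [codeSize_reverse] at this
      omega)
  simpa only [foldl_cons_eq] using h

theorem reverse {f : α → List β} (hf : PolyTime f) : PolyTime fun a => (f a).reverse := by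
  simpa using reverseAppend.comp ((const []).pair hf)

theorem append {f g : α → List β} (hf : PolyTime f) (hg : PolyTime g) :
    PolyTime fun a => f a ++ g a := by
  simpa using reverseAppend.comp (hg.pair hf.reverse)

omit [Coded α] [Coded β] [Coded γ] in
theorem foldl_flatMap_eq (f : γ × α → List β) (x : γ) (acc : List β) (l : List α) :
    l.foldl (fun (b : γ × List β) a => (b.1, b.2 ++ f (b.1, a))) (x, acc) =
      (x, acc ++ l.flatMap fun a => f (x, a)) := by
  induction l generalizing acc with
  | nil => simp
  | cons a l ih => simp [ih]

/-- The accumulator carries the parameter `x` along, because a step of `foldl` sees only the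
accumulator and the current entry. -/
theorem flatMap {f : γ × α → List β} {g : γ → List α} (hf : PolyTime f) (hg : PolyTime g) :
    PolyTime fun x => (g x).flatMap fun a => f (x, a) := by
  obtain ⟨c, hc, -⟩ := PolyTime.comp hf id
  have h := foldl (α := α) (β := γ × List β)
    (step := fun p => (p.1.1, p.1.2 ++ f (p.1.1, p.2)))
    ((fst.comp fst).pair ((snd.comp fst).append (hf.comp ((fst.comp fst).pair snd))))
    (S := fun n => n + (n * (n + 2) ^ c + 1) + 1)
    ((PolyBounded.id.add ((PolyBounded.id.mul (.pow c)).add (.const 1))).add (.const 1)) (by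
      rintro ⟨x, acc⟩ l
      rw [foldl_flatMap_eq]
      set n := codeSize ((x, acc), l) with hn
      simp only [codeSize_pair] at hn ⊢
      have h1 := codeSize_append acc (l.flatMap fun a => f (x, a))
      have h2 := codeSize_flatMap_le (l := l) (f := fun a => f (x, a)) (M := (n + 2) ^ c)
        (fun a ha => (hc _).trans (Nat.pow_le_pow_left (by
          have := codeSize_lt_of_mem ha
          rw [codeSize_pair]
          omega) c))
      have h3 : l.length * (n + 2) ^ c ≤ n * (n + 2) ^ c := Nat.mul_le_mul_right _ (by
        have := length_lt_codeSize l
        omega)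
      omega)
  simpa [foldl_flatMap_eq] using snd.comp (h.comp ((id.pair (const [])).pair hg))

theorem map {f : γ × α → β} {g : γ → List α} (hf : PolyTime f) (hg : PolyTime g) :
    PolyTime fun x => (g x).map fun a => f (x, a) := by
  have h := flatMap (f := fun p => [f p]) (hf.cons (const [])) hg
  simpa only [List.map_eq_flatMap] using h

end PolyTime

end

/-! ### Registers that a program does not mention -/

/-- All registers in `p` are below `p.bound`. -/
def Prog.bound : Prog → ℕ
  | .setNil x => x + 1
  | .copy x y => max x y + 1
  | .cons x y z => max x (max y z) + 1
  | .head x y => max x y + 1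
  | .tail x y => max x y + 1
  | .seq p q => max p.bound q.bound
  | .ite x p q => max (x + 1) (max p.bound q.bound)
  | .loop x p => max (x + 1) p.bound

/-- The counting program is specified only for stores whose other registers are `nil`. Inside the
reduction it is run while higher registers hold the formula and leftovers; it neither notices nor
changes them. -/
theorem Exec.frame {p : Prog} {s s' : Store} {t : ℕ} (h : Exec p s s' t) {n : ℕ}
    (hn : p.bound ≤ n) {u : Store} (hu : ∀ m < n, u m = s m) :
    ∃ u', Exec p u u' t ∧ (∀ m < n, u' m = s' m) ∧ ∀ m, n ≤ m → u' m = u m := by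
  have upd : ∀ {s u : Store} {x : ℕ} {d e : Data}, x < n → (∀ m < n, u m = s m) → e = d →
      (∀ m < n, Function.update u x e m = Function.update s x d m) ∧
        ∀ m, n ≤ m → Function.update u x e m = u m := by
    rintro s u x d _ hx h rfl
    refine ⟨fun m hm => ?_, fun m hm => Function.update_of_ne (by omega) _ _⟩
    by_cases hmx : m = x
    · simp [hmx]
    · simp [hmx, h m hm]
  induction h generalizing u with
  | setNil x s => exact ⟨_, .setNil x u, upd (by simp [Prog.bound] at hn; omega) hu rfl⟩
  | copy x y s =>
    simp only [Prog.bound] at hn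
    exact ⟨_, .copy x y u, upd (by omega) hu (hu y (by omega))⟩
  | cons x y z s =>
    simp only [Prog.bound] at hn
    exact ⟨_, .cons x y z u, upd (by omega) hu (by rw [hu y (by omega), hu z (by omega)])⟩
  | head x y s =>
    simp only [Prog.bound] at hn
    exact ⟨_, .head x y u, upd (by omega) hu (by rw [hu y (by omega)])⟩
  | tail x y s =>
    simp only [Prog.bound] at hn
    exact ⟨_, .tail x y u, upd (by omega) hu (by rw [hu y (by omega)])⟩
  | seq _ _ ih₁ ih₂ =>
    simp only [Prog.bound] at hn
    obtain ⟨u₁, e₁, a₁, b₁⟩ := ih₁ (by omega) hu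
    obtain ⟨u₂, e₂, a₂, b₂⟩ := ih₂ (by omega) a₁
    exact ⟨u₂, .seq e₁ e₂, a₂, fun m hm => (b₂ m hm).trans (b₁ m hm)⟩
  | iteTrue h _ ih =>
    simp only [Prog.bound] at hn
    obtain ⟨u₁, e₁, a₁, b₁⟩ := ih (by omega) hu
    exact ⟨u₁, .iteTrue (by rwa [hu _ (by omega)]) e₁, a₁, b₁⟩
  | iteFalse h _ ih =>
    simp only [Prog.bound] at hn
    obtain ⟨u₁, e₁, a₁, b₁⟩ := ih (by omega) hu
    exact ⟨u₁, .iteFalse (by rwa [hu _ (by omega)]) e₁, a₁, b₁⟩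
  | loopDone h =>
    simp only [Prog.bound] at hn
    exact ⟨u, .loopDone (by rwa [hu _ (by omega)]), hu, fun _ _ => rfl⟩
  | loopStep h _ _ ih₁ ih₂ =>
    have hn' := hn
    simp only [Prog.bound] at hn
    obtain ⟨u₁, e₁, a₁, b₁⟩ := ih₁ (by omega) hu
    obtain ⟨u₂, e₂, a₂, b₂⟩ := ih₂ hn' a₁
    exact ⟨u₂, .loopStep (by rwa [hu _ (by omega)]) e₁ e₂, a₂,
      fun m hm => (b₂ m hm).trans (b₁ m hm)⟩

end ArgTW

/-! ### Trees: the Helly property, added leaves, and cliques in tree decompositions. -/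

namespace ArgTW

/-! ### Convex sets of nodes of a graph -/

section
variable {ι : Type} {T : SimpleGraph ι}

/-- A set of nodes that contains all nodes on the paths between its members. -/
def PathConvex (T : SimpleGraph ι) (A : Set ι) : Prop :=
  ∀ (r t : ι) (p : T.Walk r t), p.IsPath → r ∈ A → t ∈ A → ∀ s ∈ p.support, s ∈ A

theorem PathConvex.inter {A B : Set ι} (hA : PathConvex T A) (hB : PathConvex T B) :
    PathConvex T (A ∩ B) := fun r t p hp hr ht s hs =>
  ⟨hA r t p hp hr.1 ht.1 s hs, hB r t p hp hr.2 ht.2 s hs⟩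

/-- The node `m` is where the path leaves `A` for the last time; the rest `q` of the path can be
extended backwards inside `A`. -/
theorem exists_last_mem (A : Set ι) {u b : ι} (p : T.Walk u b) (hp : p.IsPath)
    (h : ∃ x ∈ p.support, x ∈ A) :
    ∃ m ∈ A, m ∈ p.support ∧ ∃ q : T.Walk m b, q.IsPath ∧ ∀ x ∈ q.support, x ∈ A → x = m := by
  induction p with
  | nil =>
    obtain ⟨x, hx, hxA⟩ := h
    rw [SimpleGraph.Walk.support_nil, List.mem_singleton] at hx
    subst hx
    exact ⟨x, hxA, by simp, .nil, by simp, by simp⟩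
  | cons hadj p ih =>
    by_cases h' : ∃ x ∈ p.support, x ∈ A
    · obtain ⟨m, hm, hmp, q, hq⟩ := ih hp.of_cons h'
      exact ⟨m, hm, by simp [hmp], q, hq⟩
    · obtain ⟨x, hx, hxA⟩ := h
      rw [SimpleGraph.Walk.support_cons, List.mem_cons] at hx
      rcases hx with rfl | hx
      · refine ⟨x, hxA, by simp, .cons hadj p, hp, fun y hy hyA => ?_⟩
        rw [SimpleGraph.Walk.support_cons, List.mem_cons] at hy
        rcases hy with rfl | hy
        · rfl
        · exact (h' ⟨y, hy, hyA⟩).elim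
      · exact (h' ⟨x, hx, hxA⟩).elim

theorem exists_path (hT : T.Connected) (a b : ι) : ∃ p : T.Walk a b, p.IsPath := by
  classical
  obtain ⟨p⟩ := hT.preconnected a b
  exact ⟨p.bypass, p.bypass_isPath⟩

/-- The Helly property for three subtrees. -/
theorem PathConvex.inter_three (hT : T.Connected) {A B C : Set ι} (hA : PathConvex T A)
    (hB : PathConvex T B) (hC : PathConvex T C) (hAB : (A ∩ B).Nonempty)
    (hBC : (B ∩ C).Nonempty) (hAC : (A ∩ C).Nonempty) : (A ∩ B ∩ C).Nonempty := by
  obtain ⟨a, haA, haB⟩ := hAB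
  obtain ⟨b, hbB, hbC⟩ := hBC
  obtain ⟨c, hcA, hcC⟩ := hAC
  obtain ⟨p, hp⟩ := exists_path hT a b
  obtain ⟨m, hmA, hmp, q, hq, hqA⟩ := exists_last_mem A p hp ⟨a, p.start_mem_support, haA⟩
  obtain ⟨r, hr⟩ := exists_path hT c m
  -- By convexity `r` stays in `A`, while `q` meets `A` only in `m`. So `m` lies on a path between
  -- `c` and `b`, both in `C`; it also lies on `p`, whose ends are in `B`.
  have hrq : (r.append q).IsPath := by
    rw [SimpleGraph.Walk.isPath_def, SimpleGraph.Walk.support_append]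
    refine List.Nodup.append hr.support_nodup hq.support_nodup.tail fun x hx hxq => ?_
    have hxm := hqA x (List.mem_of_mem_tail hxq) (hA c m r hr hcA hmA x hx)
    subst hxm
    have := hq.support_nodup
    rw [← SimpleGraph.Walk.cons_tail_support] at this
    exact (List.nodup_cons.1 this).1 hxq
  refine ⟨m, ⟨hmA, hB a b p hp haB hbB m hmp⟩, hC c b _ hrq hcC hbC m ?_⟩
  rw [SimpleGraph.Walk.mem_support_append_iff]
  exact Or.inl r.end_mem_support

/-- The Helly property for subtrees. -/
theorem PathConvex.helly (hT : T.Connected) (n : ℕ) (L : List (Set ι)) (hn : L.length = n)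
    (hL : ∀ A ∈ L, PathConvex T A) (hne : ∀ A ∈ L, ∀ B ∈ L, (A ∩ B).Nonempty) :
    ∃ t, ∀ A ∈ L, t ∈ A := by
  induction n generalizing L with
  | zero =>
    obtain ⟨t⟩ := hT.nonempty
    rw [List.length_eq_zero_iff] at hn
    exact ⟨t, by simp [hn]⟩
  | succ n ih =>
    match L, hn with
    | [A], _ =>
      obtain ⟨t, ht⟩ := hne A (by simp) A (by simp)
      exact ⟨t, by simpa using ht.1⟩
    | A :: B :: L, hn =>
      -- Intersect all the other sets with `A`; they still meet pairwise by the case of three sets.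
      obtain ⟨t, ht⟩ := ih ((B :: L).map (A ∩ ·)) (by simpa using hn) (by
        intro C hC
        obtain ⟨D, hD, rfl⟩ := List.mem_map.1 hC
        exact (hL A (by simp)).inter (hL D (List.mem_cons_of_mem _ hD))) (by
        intro C hC C' hC'
        obtain ⟨D, hD, rfl⟩ := List.mem_map.1 hC
        obtain ⟨D', hD', rfl⟩ := List.mem_map.1 hC'
        have hA : A ∈ A :: B :: L := by simp
        have hD := List.mem_cons_of_mem A hD
        have hD' := List.mem_cons_of_mem A hD'
        obtain ⟨t, ⟨h1, h2⟩, h3⟩ := PathConvex.inter_three hT (hL A hA) (hL D hD) (hL D' hD')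
          (hne A hA D hD) (hne D hD D' hD') (hne A hA D' hD')
        exact ⟨t, ⟨h1, h2⟩, h1, h3⟩)
      refine ⟨t, fun C hC => ?_⟩
      rcases List.mem_cons.1 hC with rfl | hC
      · exact (ht _ (List.mem_map_of_mem (a := B) (by simp))).1
      · exact (ht _ (List.mem_map_of_mem hC)).2

/-! ### Attaching leaves to a tree -/

variable {κ : Type}

/-- The graph `T` with a new leaf `inr i` attached to the node `h i`, for every `i`. -/
def attachLeaves (T : SimpleGraph ι) (h : κ → ι) : SimpleGraph (ι ⊕ κ) where
  Adj
    | .inl s, .inl t => T.Adj s t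
    | .inl s, .inr i => s = h i
    | .inr i, .inl s => s = h i
    | .inr _, .inr _ => False
  symm := ⟨by rintro (s | i) (t | j) <;> simp +contextual [T.adj_comm]⟩
  loopless := ⟨by rintro (s | i) <;> simp⟩

def attachLeavesHom (T : SimpleGraph ι) (h : κ → ι) : T →g attachLeaves T h where
  toFun := Sum.inl
  map_rel' := fun hst => hst

theorem attachLeaves_connected (hT : T.Connected) (h : κ → ι) : (attachLeaves T h).Connected := by
  have key : ∀ x : ι ⊕ κ, ∃ t, (attachLeaves T h).Reachable x (.inl t) := by
    rintro (t | i)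
    · exact ⟨t, .refl _⟩
    · exact ⟨h i, SimpleGraph.Adj.reachable (G := attachLeaves T h)
        (u := .inr i) (v := .inl (h i)) rfl⟩
  have : Nonempty (ι ⊕ κ) := hT.nonempty.map .inl
  refine ⟨fun x y => ?_⟩
  obtain ⟨s, hs⟩ := key x
  obtain ⟨t, ht⟩ := key y
  exact hs.trans (((hT.preconnected s t).map (attachLeavesHom T h)).trans ht.symm)

/-- Every edge is a bridge. Deleting the edge of a leaf isolates the leaf. For an edge of `T`, a
walk around it would give one in `T` after each leaf is collapsed to the node it hangs at. -/
theorem attachLeaves_acyclic (hT : T.IsAcyclic) (h : κ → ι) :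
    (attachLeaves T h).IsAcyclic := by
  rw [SimpleGraph.isAcyclic_iff_forall_adj_isBridge] at hT ⊢
  have leaf : ∀ i, (attachLeaves T h).IsBridge s(.inr i, .inl (h i)) := by
    intro i
    rw [SimpleGraph.isBridge_iff]
    rintro ⟨p⟩
    cases p with
    | cons hadj _ =>
      rename_i v _
      rw [SimpleGraph.deleteEdges_adj] at hadj
      obtain ⟨h1, h2⟩ := hadj
      rcases v with s | j
      · have h1 : s = h i := h1
        simp [h1] at h2
      · exact h1
  rintro (s | i) (t | j) hst
  · have hst' : T.Adj s t := hst
    have hb := hT hst'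
    rw [SimpleGraph.isBridge_iff] at hb ⊢
    rintro ⟨p⟩
    apply hb
    have key : ∀ x y (_ : ((attachLeaves T h).deleteEdges {s(.inl s, .inl t)}).Walk x y),
        (T.deleteEdges {s(s, t)}).Reachable (Sum.elim (fun t => t) h x)
          (Sum.elim (fun t => t) h y) := by
      intro x y p
      induction p with
      | nil => exact .refl _
      | cons hadj _ ih =>
        refine .trans ?_ ih
        rename_i u v _ _
        rw [SimpleGraph.deleteEdges_adj] at hadj
        obtain ⟨h1, h2⟩ := hadj
        rcases u with u | u <;> rcases v with v | v
        · refine SimpleGraph.Adj.reachable ?_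
          rw [SimpleGraph.deleteEdges_adj]
          exact ⟨h1, by simpa using h2⟩
        · have h1 : u = h v := h1
          simp [h1]
        · have h1 : v = h u := h1
          simp [h1]
        · exact h1.elim
    exact key _ _ p
  · have hst' : s = h j := hst
    subst hst'
    rw [Sym2.eq_swap]
    exact leaf j
  · have hst' : t = h i := hst
    subst hst'
    exact leaf i
  · exact hst.elim

/-- In a tree it suffices to connect two bags with a common vertex by some walk. -/
theorem forall_path_of_exists_walk {T : SimpleGraph ι} (hT : T.IsAcyclic) {P : ι → Prop}
    {r t : ι} (h : ∃ w : T.Walk r t, ∀ s ∈ w.support, P s) (p : T.Walk r t) (hp : p.IsPath) :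
    ∀ s ∈ p.support, P s := by
  classical
  obtain ⟨w, hw⟩ := h
  have := (hT.subsingleton_path r t).elim ⟨p, hp⟩ ⟨w.bypass, w.bypass_isPath⟩
  have : p = w.bypass := congrArg Subtype.val this
  subst this
  exact fun s hs => hw s (w.support_bypass_subset_support hs)

/-- A property of the nodes of `attachLeaves T h` that holds on a connected part of `T` and on some
leaves attached to this part. -/
theorem attachLeaves_walk (h : κ → ι) {P : ι ⊕ κ → Prop}
    (hP : ∀ r t, P (.inl r) → P (.inl t) →
      ∃ w : T.Walk r t, ∀ s ∈ w.support, P (.inl s))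
    (hleaf : ∀ i, P (.inr i) → P (.inl (h i))) (x y : ι ⊕ κ) (hx : P x) (hy : P y) :
    ∃ w : (attachLeaves T h).Walk x y, ∀ s ∈ w.support, P s := by
  have key : ∀ x, P x → ∃ r, P (.inl r) ∧
      ∃ w : (attachLeaves T h).Walk x (.inl r), ∀ s ∈ w.support, P s := by
    rintro (r | i) hx
    · exact ⟨r, hx, .nil, by simpa using hx⟩
    · refine ⟨h i, hleaf i hx, .cons (show (attachLeaves T h).Adj (.inr i) (.inl (h i)) from rfl)
        .nil, ?_⟩
      simp [hx, hleaf i hx]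
  obtain ⟨r, hr, w, hw⟩ := key x hx
  obtain ⟨t, ht, w', hw'⟩ := key y hy
  obtain ⟨q, hq⟩ := hP r t hr ht
  obtain ⟨q', hq'⟩ : ∃ q' : (attachLeaves T h).Walk (.inl r) (.inl t), ∀ s ∈ q'.support, P s := by
    refine ⟨q.map (attachLeavesHom T h), fun s hs => ?_⟩
    have hs := (SimpleGraph.Walk.support_map (attachLeavesHom T h) q) ▸ hs
    obtain ⟨a, ha, rfl⟩ := List.mem_map.1 hs
    exact hq a ha
  refine ⟨w.append (q'.append w'.reverse), fun s hs => ?_⟩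
  simp only [SimpleGraph.Walk.mem_support_append_iff,
    SimpleGraph.Walk.support_reverse, List.mem_reverse] at hs
  rcases hs with hs | hs | hs
  · exact hw s hs
  · exact hq' s hs
  · exact hw' s hs

end

/-! ### Tree decompositions -/

section
variable {V : Type} {G : SimpleGraph V}

theorem TreeDecomposition.pathConvex {ι : Type} (D : TreeDecomposition G ι) (v : V) :
    PathConvex D.T {t | v ∈ D.bag t} :=
  fun r t p hp hr ht s hs => D.path_inter r t p hp s hs v hr ht

theorem TreeDecomposition.exists_walk {ι : Type} (D : TreeDecomposition G ι) {v : V} {r t : ι}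
    (hr : v ∈ D.bag r) (ht : v ∈ D.bag t) : ∃ w : D.T.Walk r t, ∀ s ∈ w.support, v ∈ D.bag s := by
  obtain ⟨p, hp⟩ := exists_path D.isTree.connected r t
  exact ⟨p, fun s hs => D.path_inter r t p hp s hs v hr ht⟩

/-- A clique is contained in a bag. -/
theorem TreeDecomposition.exists_clique_subset {ι : Type} (D : TreeDecomposition G ι)
    (K : List V) (hK : ∀ u ∈ K, ∀ v ∈ K, u ≠ v → G.Adj u v) : ∃ t, ∀ v ∈ K, v ∈ D.bag t := by
  -- Helly for the subtrees of the members of `K`; those of adjacent vertices share a node by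
  -- `edge_mem`.
  obtain ⟨t, ht⟩ := PathConvex.helly D.isTree.connected _ (K.map fun v => {t | v ∈ D.bag t}) rfl
    (by
      intro A hA
      obtain ⟨v, -, rfl⟩ := List.mem_map.1 hA
      exact D.pathConvex v)
    (by
      intro A hA B hB
      obtain ⟨u, hu, rfl⟩ := List.mem_map.1 hA
      obtain ⟨v, hv, rfl⟩ := List.mem_map.1 hB
      by_cases huv : u = v
      · subst huv
        obtain ⟨t, ht⟩ := D.vertex_mem u
        exact ⟨t, ht, ht⟩
      · exact D.edge_mem u v (hK u hu v hv huv))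
  exact ⟨t, fun v hv => ht _ (List.mem_map_of_mem hv)⟩

/-- The decomposition with a single bag shows that the set of widths is nonempty, so that its
infimum is attained. -/
theorem exists_treeDecomposition [Finite V] (G : SimpleGraph V) :
    ∃ (ι : Type) (_ : Fintype ι) (D : TreeDecomposition G ι), D.width = treewidth G := by
  have := Fintype.ofFinite V
  have h : {w : ℕ | ∃ (ι : Type) (_ : Fintype ι) (D : TreeDecomposition G ι),
      D.width = w}.Nonempty := by
    refine ⟨_, Unit, inferInstance, ⟨⊥, ?_, fun _ => Finset.univ, ?_, ?_, ?_⟩, rfl⟩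
    · exact .of_subsingleton
    · exact fun v => ⟨(), Finset.mem_univ v⟩
    · exact fun u v _ => ⟨(), Finset.mem_univ u, Finset.mem_univ v⟩
    · exact fun _ _ _ _ _ _ v _ _ => Finset.mem_univ v
  exact Nat.sInf_mem h

theorem treewidth_le_width {ι : Type} [inst : Fintype ι] (D : TreeDecomposition G ι) :
    treewidth G ≤ D.width := Nat.sInf_le ⟨ι, inst, D, rfl⟩

theorem TreeDecomposition.width_le {ι : Type} [Fintype ι] (D : TreeDecomposition G ι) {w : ℕ}
    (h : ∀ t, (D.bag t).card ≤ w + 1) : D.width ≤ w := by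
  have := Finset.sup_le (s := Finset.univ) (f := fun t => (D.bag t).card) fun t _ => h t
  unfold TreeDecomposition.width
  omega

theorem TreeDecomposition.card_bag_le {ι : Type} [Fintype ι] (D : TreeDecomposition G ι) (t : ι) :
    (D.bag t).card ≤ D.width + 1 := by
  have := Finset.le_sup (f := fun t => (D.bag t).card) (Finset.mem_univ t)
  unfold TreeDecomposition.width
  omega

end

end ArgTW

/-! ### The framework of clauses and its extensions under the three semantics. -/

namespace ArgTW

/-! ### The framework of a quantified formula -/

/-- Arguments over the variables `V`: the literals, a marker `dl v b` that shows in the range of a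
set whether the literal `lit v b` was chosen, the clauses, the formula `phi`, the guard `beta` of
the literals of the innermost block, and an isolated argument `top`. -/
inductive Arg (V : Type)
  | lit (v : V) (b : Bool)
  | dl (v : V) (b : Bool)
  | cl (i : ℕ)
  | phi
  | beta
  | top

open Arg

variable {V : Type}

/-- The arguments and attacks of the framework for the clauses `C 0, …, C (m - 1)`, where `Z` are
the variables of the innermost block and `XY` are the other variables. -/
structure Encodes (F : AF (Arg V)) (XY Z : V → Prop) (m : ℕ) (C : ℕ → V → Bool → Prop) :
    Prop where
  disj : ∀ v, XY v → ¬ Z v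
  closed : ∀ i v b, i < m → C i v b → XY v ∨ Z v
  args_lit : ∀ v b, lit v b ∈ F.args ↔ XY v ∨ Z v
  args_dl : ∀ v b, dl v b ∈ F.args ↔ XY v
  args_cl : ∀ i, cl i ∈ F.args ↔ i < m
  args_phi : phi ∈ F.args
  args_beta : beta ∈ F.args
  args_top : top ∈ F.args
  att_lit : ∀ a v b, (a, lit v b) ∈ F.attacks ↔
    (a = lit v (!b) ∧ (XY v ∨ Z v)) ∨ (a = beta ∧ Z v)
  att_dl : ∀ a v b, (a, dl v b) ∈ F.attacks ↔ XY v ∧ (a = lit v b ∨ a = dl v b)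
  att_cl : ∀ a i, (a, cl i) ∈ F.attacks ↔ i < m ∧ ∃ v b, a = lit v b ∧ C i v b
  att_phi : ∀ a, (a, phi) ∈ F.attacks ↔ ∃ i < m, a = cl i
  att_beta : ∀ a, (a, beta) ∈ F.attacks ↔ a = phi ∨ a = beta
  att_top : ∀ a, (a, top) ∉ F.attacks

/-- The assignment `τ` satisfies the first `m` clauses. -/
def SatClauses (m : ℕ) (C : ℕ → V → Bool → Prop) (τ : V → Bool) : Prop :=
  ∀ i < m, ∃ v, C i v (τ v)

/-- `S` contains exactly the literals over `U` that are true under `τ`. -/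
def AgreesOn (U : V → Prop) (S : Set (Arg V)) (τ : V → Bool) : Prop :=
  ∀ v b, U v → (lit v b ∈ S ↔ b = τ v)

namespace Encodes

variable {F : AF (Arg V)} {XY Z : V → Prop} {m : ℕ} {C : ℕ → V → Bool → Prop}
  {S S' : Set (Arg V)} {τ : V → Bool}

theorem conflictFree_iff (h : Encodes F XY Z m C) : F.ConflictFree S ↔
    S ⊆ ↑F.args ∧ (∀ v b, dl v b ∉ S) ∧ beta ∉ S ∧ (∀ v b, lit v b ∈ S → lit v (!b) ∉ S) ∧
    (∀ i v b, cl i ∈ S → C i v b → lit v b ∉ S) ∧ (phi ∈ S → ∀ i, cl i ∉ S) := by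
  constructor
  · rintro ⟨hS, hc⟩
    refine ⟨hS, fun v b hd => ?_, fun hb => ?_, fun v b h1 h2 => ?_, fun i v b h1 h2 h3 => ?_,
      fun h1 i h2 => ?_⟩
    · exact hc _ hd _ hd ((h.att_dl _ _ _).2 ⟨(h.args_dl v b).1 (hS hd), .inr rfl⟩)
    · exact hc _ hb _ hb ((h.att_beta _).2 (.inr rfl))
    · exact hc _ h2 _ h1 ((h.att_lit _ _ _).2 (.inl ⟨rfl, (h.args_lit v b).1 (hS h1)⟩))
    · exact hc _ h3 _ h1 ((h.att_cl _ _).2 ⟨(h.args_cl i).1 (hS h1), v, b, rfl, h2⟩)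
    · exact hc _ h2 _ h1 ((h.att_phi _).2 ⟨i, (h.args_cl i).1 (hS h2), rfl⟩)
  · rintro ⟨hS, hd, hb, hl, hcl, hp⟩
    refine ⟨hS, fun x hx a ha hr => ?_⟩
    cases a with
    | lit v b =>
      rw [h.att_lit] at hr
      rcases hr with ⟨rfl, -⟩ | ⟨rfl, -⟩
      · exact hl v b ha hx
      · exact hb hx
    | dl v b => exact hd v b ha
    | cl i =>
      rw [h.att_cl] at hr
      obtain ⟨-, v, b, rfl, hC⟩ := hr
      exact hcl i v b ha hC hx
    | phi =>
      rw [h.att_phi] at hr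
      obtain ⟨i, -, rfl⟩ := hr
      exact hp ha i hx
    | beta => exact hb ha
    | top => exact h.att_top x hr

/-- A literal defends itself against its complement. What remains: only `phi` can defend against
`beta`, only the complement against a literal that attacks a clause, and only literals against a
clause that attacks `phi`. -/
theorem admissible_iff (h : Encodes F XY Z m C) : F.Admissible S ↔ F.ConflictFree S ∧
    (∀ v b, Z v → lit v b ∈ S → phi ∈ S) ∧
    (∀ i v b, cl i ∈ S → C i v b → lit v (!b) ∈ S) ∧
    (phi ∈ S → ∀ i < m, ∃ v b, C i v b ∧ lit v b ∈ S) := by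
  refine and_congr_right fun hcf => ?_
  have hcf' := h.conflictFree_iff.1 hcf
  obtain ⟨hS, hd, hb, hl, hcl, hp⟩ := hcf'
  constructor
  · intro hD
    refine ⟨fun v b hZ hv => ?_, fun i v b hi hC => ?_, fun hphi i hi => ?_⟩
    · obtain ⟨s, hs, hr⟩ := hD _ hv beta ((h.att_lit _ _ _).2 (.inr ⟨rfl, hZ⟩))
      rw [h.att_beta] at hr
      rcases hr with rfl | rfl
      · exact hs
      · exact (hb hs).elim
    · obtain ⟨s, hs, hr⟩ := hD _ hi (lit v b)
        ((h.att_cl _ _).2 ⟨(h.args_cl i).1 (hS hi), v, b, rfl, hC⟩)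
      rw [h.att_lit] at hr
      rcases hr with ⟨rfl, -⟩ | ⟨rfl, -⟩
      · exact hs
      · exact (hb hs).elim
    · obtain ⟨s, hs, hr⟩ := hD _ hphi (cl i) ((h.att_phi _).2 ⟨i, hi, rfl⟩)
      rw [h.att_cl] at hr
      obtain ⟨-, v, b, rfl, hC⟩ := hr
      exact ⟨v, b, hC, hs⟩
  · rintro ⟨hZ, hC, hphi⟩ a ha x hr
    cases a with
    | lit v b =>
      have hv := (h.args_lit v b).1 (hS ha)
      rw [h.att_lit] at hr
      rcases hr with ⟨rfl, -⟩ | ⟨rfl, hZv⟩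
      · exact ⟨_, ha, (h.att_lit _ _ _).2 (.inl ⟨by simp, hv⟩)⟩
      · exact ⟨phi, hZ v b hZv ha, (h.att_beta _).2 (.inl rfl)⟩
    | dl v b => exact (hd v b ha).elim
    | cl i =>
      rw [h.att_cl] at hr
      obtain ⟨hi, v, b, rfl, hCi⟩ := hr
      exact ⟨_, hC i v b ha hCi, (h.att_lit _ _ _).2 (.inl ⟨rfl, h.closed i v b hi hCi⟩)⟩
    | phi =>
      rw [h.att_phi] at hr
      obtain ⟨i, hi, rfl⟩ := hr
      obtain ⟨v, b, hCi, hv⟩ := hphi ha i hi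
      exact ⟨_, hv, (h.att_cl _ _).2 ⟨hi, v, b, rfl, hCi⟩⟩
    | beta => exact (hb ha).elim
    | top => exact (h.att_top x hr).elim

/-! ### Ranges -/

theorem mem_range_iff {a : Arg V} :
    a ∈ F.range S ↔ a ∈ S ∨ ∃ b ∈ S, (b, a) ∈ F.attacks := Iff.rfl

theorem range_subset_args (h : F.ConflictFree S) : F.range S ⊆ ↑F.args := by
  rintro a (ha | ⟨b, -, hb⟩)
  · exact h.1 ha
  · exact (F.attacks_sub _ hb).2

/-- A marker attacks itself and has one other attacker. Hence the range, which contains both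
literals of a variable as soon as one is chosen, still reveals the choice. -/
theorem dl_mem_range (h : Encodes F XY Z m C) (hS : F.ConflictFree S) {v : V} (b : Bool)
    (hv : XY v) : dl v b ∈ F.range S ↔ lit v b ∈ S := by
  have hd := (h.conflictFree_iff.1 hS).2.1
  rw [mem_range_iff]
  constructor
  · rintro (hS | ⟨a, ha, hr⟩)
    · exact (hd _ _ hS).elim
    · rw [h.att_dl] at hr
      rcases hr with ⟨-, rfl | rfl⟩
      · exact ha
      · exact (hd _ _ ha).elim
  · exact fun hl => .inr ⟨_, hl, (h.att_dl _ _ _).2 ⟨hv, .inl rfl⟩⟩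

theorem beta_mem_range (h : Encodes F XY Z m C) (hS : F.ConflictFree S) :
    beta ∈ F.range S ↔ phi ∈ S := by
  have hb := (h.conflictFree_iff.1 hS).2.2.1
  rw [mem_range_iff]
  constructor
  · rintro (hS | ⟨a, ha, hr⟩)
    · exact (hb hS).elim
    · rw [h.att_beta] at hr
      rcases hr with rfl | rfl
      · exact ha
      · exact (hb ha).elim
  · exact fun hl => .inr ⟨_, hl, (h.att_beta _).2 (.inl rfl)⟩

theorem cl_mem_range (h : Encodes F XY Z m C) {i : ℕ} (hi : i < m) :
    cl i ∈ F.range S ↔ cl i ∈ S ∨ ∃ v b, lit v b ∈ S ∧ C i v b := by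
  rw [mem_range_iff]
  refine or_congr_right ⟨?_, ?_⟩
  · rintro ⟨a, ha, hr⟩
    rw [h.att_cl] at hr
    obtain ⟨-, v, b, rfl, hC⟩ := hr
    exact ⟨v, b, ha, hC⟩
  · rintro ⟨v, b, hv, hC⟩
    exact ⟨_, hv, (h.att_cl _ _).2 ⟨hi, v, b, rfl, hC⟩⟩

theorem phi_mem_range (h : Encodes F XY Z m C) :
    phi ∈ F.range S ↔ phi ∈ S ∨ ∃ i < m, cl i ∈ S := by
  rw [mem_range_iff]
  refine or_congr_right ⟨?_, ?_⟩
  · rintro ⟨a, ha, hr⟩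
    rw [h.att_phi] at hr
    obtain ⟨i, hi, rfl⟩ := hr
    exact ⟨i, hi, ha⟩
  · rintro ⟨i, hi, hS⟩
    exact ⟨_, hS, (h.att_phi _).2 ⟨i, hi, rfl⟩⟩

theorem top_mem_range (h : Encodes F XY Z m C) : top ∈ F.range S ↔ top ∈ S := by
  simp [mem_range_iff, h.att_top]

theorem lit_mem_range_of_mem (h : Encodes F XY Z m C) {v : V} {b : Bool} (c : Bool)
    (hv : XY v ∨ Z v) (hb : lit v b ∈ S) : lit v c ∈ F.range S := by
  by_cases hc : c = b
  · exact .inl (hc ▸ hb)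
  · refine .inr ⟨_, hb, (h.att_lit _ _ _).2 (.inl ⟨?_, hv⟩)⟩
    cases b <;> cases c <;> simp_all

/-- Larger ranges contain the same literals of `XY`. -/
theorem AgreesOn.of_range_subset (h : Encodes F XY Z m C) (hS : F.ConflictFree S)
    (hS' : F.ConflictFree S') (ha : AgreesOn XY S τ) (hr : F.range S ⊆ F.range S') :
    AgreesOn XY S' τ := by
  intro v b hv
  have h1 : lit v (τ v) ∈ S' := by
    rw [← h.dl_mem_range hS' _ hv]
    apply hr
    rw [h.dl_mem_range hS _ hv, ha v _ hv]
  have h2 := (h.conflictFree_iff.1 hS').2.2.2.1 v _ h1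
  constructor
  · intro hb
    by_contra hne
    have : b = !τ v := by cases b <;> cases h : τ v <;> simp_all
    exact h2 (this ▸ hb)
  · rintro rfl
    exact h1

/-- The literals in `S` are true under some assignment, which can be chosen to extend `τ`. -/
theorem exists_assignment (h : Encodes F XY Z m C) (hS : F.ConflictFree S)
    (ha : AgreesOn XY S τ) : ∃ τ' : V → Bool, (∀ v, XY v → τ' v = τ v) ∧
      ∀ v b, lit v b ∈ S → b = τ' v := by
  classical
  have hl := (h.conflictFree_iff.1 hS).2.2.2.1
  refine ⟨fun v => if XY v then τ v else decide (lit v true ∈ S), fun v hv => if_pos hv,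
    fun v b hv => ?_⟩
  by_cases hXY : XY v
  · simpa [hXY] using (ha v b hXY).1 hv
  · cases b with
    | true => simp [hXY, hv]
    | false => simpa [hXY] using hl v false hv

/-! ### Extensions with `phi` -/

/-- All literals that are true under `τ`, with `phi`. -/
def satSet (XY Z : V → Prop) (τ : V → Bool) : Set (Arg V)
  | lit v b => (XY v ∨ Z v) ∧ b = τ v
  | phi => True
  | top => True
  | _ => False

theorem satSet_conflictFree (h : Encodes F XY Z m C) : F.ConflictFree (satSet XY Z τ) := by
  rw [h.conflictFree_iff]
  refine ⟨?_, fun _ _ => id, id, ?_, fun _ _ _ => False.elim, fun _ _ => id⟩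
  · rintro (⟨v, b⟩ | ⟨v, b⟩ | i | _ | _ | _) ha
    exacts [(h.args_lit v b).2 ha.1, ha.elim, ha.elim, h.args_phi, ha.elim, h.args_top]
  · rintro v b ⟨-, h1⟩ ⟨-, h2⟩
    rw [← h1] at h2
    cases b <;> simp at h2

theorem satSet_admissible (h : Encodes F XY Z m C) (hτ : SatClauses m C τ) :
    F.Admissible (satSet XY Z τ) := by
  rw [h.admissible_iff]
  refine ⟨h.satSet_conflictFree, fun _ _ _ _ => trivial, fun _ _ _ => False.elim, ?_⟩
  intro _ i hi
  obtain ⟨v, hv⟩ := hτ i hi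
  exact ⟨v, τ v, hv, h.closed i v _ hi hv, rfl⟩

theorem satSet_agreesOn : AgreesOn XY (satSet XY Z τ) τ :=
  fun _ _ hv => ⟨fun hb => hb.2, fun hb => ⟨.inl hv, hb⟩⟩

/-- The range of `satSet` misses only the markers of outer literals that are false under `τ`, and
these are excluded from the range of `S` by the hypothesis on its literals. -/
theorem range_subset_satSet (h : Encodes F XY Z m C) (hτ : SatClauses m C τ)
    (hS : F.ConflictFree S) (ha : ∀ v b, XY v → lit v b ∈ S → b = τ v) :
    F.range S ⊆ F.range (satSet XY Z τ) := by
  intro a ha'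
  have hargs := range_subset_args hS ha'
  rcases a with (⟨v, b⟩ | ⟨v, b⟩ | i | _ | _ | _)
  · have hv := (h.args_lit v b).1 hargs
    exact h.lit_mem_range_of_mem b hv (b := τ v) ⟨hv, rfl⟩
  · have hv := (h.args_dl v b).1 hargs
    rw [h.dl_mem_range hS _ hv] at ha'
    rw [h.dl_mem_range h.satSet_conflictFree _ hv]
    exact ⟨.inl hv, ha v b hv ha'⟩
  · have hi := (h.args_cl i).1 hargs
    obtain ⟨v, hv⟩ := hτ i hi
    exact (h.cl_mem_range hi).2 (.inr ⟨v, τ v, ⟨h.closed i v _ hi hv, rfl⟩, hv⟩)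
  · exact .inl trivial
  · exact (h.beta_mem_range h.satSet_conflictFree).2 trivial
  · exact .inl trivial

theorem range_ssubset_satSet (h : Encodes F XY Z m C) (hτ : SatClauses m C τ)
    (hS : F.ConflictFree S) (ha : ∀ v b, XY v → lit v b ∈ S → b = τ v) (hphi : phi ∉ S) :
    F.range S ⊂ F.range (satSet XY Z τ) := by
  refine ⟨h.range_subset_satSet hτ hS ha, fun hr => hphi ?_⟩
  rw [← h.beta_mem_range hS]
  exact hr ((h.beta_mem_range h.satSet_conflictFree).2 trivial)

/-- A larger range forces the same outer literals, by the markers, and `satSet` dominates all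
conflict-free sets with these literals. -/
theorem satSet_range_maximal (h : Encodes F XY Z m C) (hτ : SatClauses m C τ)
    (hS : F.ConflictFree S) : ¬ F.range (satSet XY Z τ) ⊂ F.range S := by
  intro hr
  have ha := AgreesOn.of_range_subset h h.satSet_conflictFree hS satSet_agreesOn hr.1
  exact hr.2 (h.range_subset_satSet hτ hS fun v b hv => (ha v b hv).1)

theorem satSet_isExtension (h : Encodes F XY Z m C) (hτ : SatClauses m C τ) (σ : Semantics) :
    F.IsExtension σ (satSet XY Z τ) := by
  cases σ with
  | preferred =>
    refine ⟨h.satSet_admissible hτ, ?_⟩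
    rintro ⟨S, hS, hsub, hne⟩
    refine hne fun a ha => ?_
    obtain ⟨h0, h1, h2, h3, -, h5⟩ := h.conflictFree_iff.1 hS.1
    rcases a with (⟨v, b⟩ | ⟨v, b⟩ | i | _ | _ | _)
    · have hv := (h.args_lit v b).1 (h0 ha)
      refine ⟨hv, ?_⟩
      by_contra hb
      have hb : τ v = !b := by cases b <;> cases h : τ v <;> simp_all
      exact h3 v b ha (hsub ⟨hv, hb.symm⟩)
    exacts [h1 v b ha, h5 (hsub trivial) i ha, trivial, h2 ha, trivial]
  | semiStable =>
    exact ⟨h.satSet_admissible hτ, fun ⟨S, hS, hr⟩ => h.satSet_range_maximal hτ hS.1 hr⟩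
  | stage =>
    exact ⟨h.satSet_conflictFree, fun ⟨S, hS, hr⟩ => h.satSet_range_maximal hτ hS hr⟩

/-! ### Extensions without `phi` -/

/-- No assignment that agrees with `τ` outside of the innermost block satisfies the clauses. -/
def Refuted (XY : V → Prop) (m : ℕ) (C : ℕ → V → Bool → Prop) (τ : V → Bool) : Prop :=
  ∀ τ' : V → Bool, (∀ v, XY v → τ' v = τ v) → ¬ SatClauses m C τ'

/-- The literals of `XY` that are true under `τ`, with the clauses that they falsify. -/
def refSet (XY : V → Prop) (m : ℕ) (C : ℕ → V → Bool → Prop) (τ : V → Bool) : Set (Arg V)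
  | lit v b => XY v ∧ b = τ v
  | cl i => i < m ∧ ∀ v b, C i v b → XY v ∧ b = !τ v
  | top => True
  | _ => False

theorem refSet_admissible (h : Encodes F XY Z m C) : F.Admissible (refSet XY m C τ) := by
  rw [h.admissible_iff, h.conflictFree_iff]
  refine ⟨⟨?_, fun _ _ => id, id, ?_, ?_, False.elim⟩, ?_, ?_, False.elim⟩
  · rintro (⟨v, b⟩ | ⟨v, b⟩ | i | _ | _ | _) ha
    exacts [(h.args_lit v b).2 (.inl ha.1), ha.elim, (h.args_cl i).2 ha.1, ha.elim, ha.elim,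
      h.args_top]
  · rintro v b ⟨-, h1⟩ ⟨-, h2⟩
    rw [← h1] at h2
    cases b <;> simp at h2
  · rintro i v b ⟨-, hi⟩ hC ⟨-, hb⟩
    have := (hi v b hC).2
    rw [← hb] at this
    cases b <;> simp at this
  · exact fun v b hZ hl => (h.disj v hl.1 hZ).elim
  · rintro i v b ⟨-, hi⟩ hC
    obtain ⟨h1, h2⟩ := hi v b hC
    exact ⟨h1, by simp [h2]⟩

/-- Since `τ` is refuted, `phi` cannot be defended; then `beta` rules out all inner literals. A
clause in `S` needs the complements of all its literals, so these are outer and false. Thus `refSet`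
is the greatest admissible set that agrees with `τ`. -/
theorem subset_refSet (h : Encodes F XY Z m C) (hτ : Refuted XY m C τ) (hS : F.Admissible S)
    (ha : AgreesOn XY S τ) : S ⊆ refSet XY m C τ := by
  obtain ⟨hcf, hZ, hC, hphi⟩ := h.admissible_iff.1 hS
  obtain ⟨h0, h1, h2, -, -, -⟩ := h.conflictFree_iff.1 hcf
  have hphi : phi ∉ S := by
    intro hp
    obtain ⟨τ', ht, hl⟩ := h.exists_assignment hcf ha
    refine hτ τ' ht fun i hi => ?_
    obtain ⟨v, b, hCi, hv⟩ := hphi hp i hi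
    exact ⟨v, hl v b hv ▸ hCi⟩
  have hXY : ∀ v b, lit v b ∈ S → XY v := fun v b hv =>
    ((h.args_lit v b).1 (h0 hv)).resolve_right fun hz => hphi (hZ v b hz hv)
  rintro (⟨v, b⟩ | ⟨v, b⟩ | i | _ | _ | _) hx
  · exact ⟨hXY v b hx, (ha v b (hXY v b hx)).1 hx⟩
  · exact h1 v b hx
  · refine ⟨(h.args_cl i).1 (h0 hx), fun v b hCi => ?_⟩
    have hv := hC i v b hx hCi
    exact ⟨hXY _ _ hv, by rw [← (ha v _ (hXY _ _ hv)).1 hv, Bool.not_not]⟩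
  · exact hphi hx
  · exact h2 hx
  · trivial

theorem refSet_agreesOn : AgreesOn XY (refSet XY m C τ) τ :=
  fun _ _ hv => ⟨fun hb => hb.2, fun hb => ⟨hv, hb⟩⟩

/-- All literals that are true under `τ`, with the clauses that they falsify, or with `phi` if there
is no such clause. -/
def falseSet (XY Z : V → Prop) (m : ℕ) (C : ℕ → V → Bool → Prop) (τ : V → Bool) : Set (Arg V)
  | lit v b => (XY v ∨ Z v) ∧ b = τ v
  | cl i => i < m ∧ ∀ v b, C i v b → b = !τ v
  | phi => SatClauses m C τ
  | top => True
  | _ => False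

theorem falseSet_agreesOn : AgreesOn XY (falseSet XY Z m C τ) τ :=
  fun _ _ hv => ⟨fun hb => hb.2, fun hb => ⟨.inl hv, hb⟩⟩

theorem falseSet_conflictFree (h : Encodes F XY Z m C) :
    F.ConflictFree (falseSet XY Z m C τ) := by
  rw [h.conflictFree_iff]
  refine ⟨?_, fun _ _ => id, id, ?_, ?_, ?_⟩
  · rintro (⟨v, b⟩ | ⟨v, b⟩ | i | _ | _ | _) ha
    exacts [(h.args_lit v b).2 ha.1, ha.elim, (h.args_cl i).2 ha.1, h.args_phi, ha.elim,
      h.args_top]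
  · rintro v b ⟨-, h1⟩ ⟨-, h2⟩
    rw [← h1] at h2
    cases b <;> simp at h2
  · rintro i v b ⟨-, hi⟩ hC ⟨-, hb⟩
    have := hi v b hC
    rw [← hb] at this
    cases b <;> simp at this
  · rintro hs i ⟨hi, hf⟩
    obtain ⟨v, hv⟩ := hs i hi
    have := hf v _ hv
    cases h : τ v <;> simp [h] at this

/-- Each clause is either falsified, hence a member, or attacked by a true literal; and `phi` is a
member or attacked by a falsified clause. Among the arguments other than markers, only `beta` can be
missing, and it is outside the range of `S` because `phi ∉ S`. -/
theorem range_subset_falseSet (h : Encodes F XY Z m C) (hS : F.ConflictFree S)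
    (ha : ∀ v b, XY v → lit v b ∈ S → b = τ v) (hphi : phi ∉ S) :
    F.range S ⊆ F.range (falseSet XY Z m C τ) := by
  intro a ha'
  have hargs := range_subset_args hS ha'
  rcases a with (⟨v, b⟩ | ⟨v, b⟩ | i | _ | _ | _)
  · have hv := (h.args_lit v b).1 hargs
    exact h.lit_mem_range_of_mem b hv (b := τ v) ⟨hv, rfl⟩
  · have hv := (h.args_dl v b).1 hargs
    rw [h.dl_mem_range hS _ hv] at ha'
    rw [h.dl_mem_range h.falseSet_conflictFree _ hv]
    exact ⟨.inl hv, ha v b hv ha'⟩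
  · have hi := (h.args_cl i).1 hargs
    rw [h.cl_mem_range hi]
    by_cases hf : ∀ v b, C i v b → b = !τ v
    · exact .inl ⟨hi, hf⟩
    · push Not at hf
      obtain ⟨v, b, hC, hb⟩ := hf
      exact .inr ⟨v, b, ⟨h.closed i v b hi hC, by cases b <;> cases h : τ v <;> simp_all⟩, hC⟩
  · rw [h.phi_mem_range]
    by_cases hs : SatClauses m C τ
    · exact .inl hs
    · unfold SatClauses at hs
      push Not at hs
      obtain ⟨i, hi, hf⟩ := hs
      refine .inr ⟨i, hi, hi, fun v b hC => ?_⟩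
      by_contra hb
      have hb : b = τ v := by cases b <;> cases h : τ v <;> simp_all
      exact hf v (hb ▸ hC)
  · exact (hphi ((h.beta_mem_range hS).1 ha')).elim
  · exact .inl trivial

/-- For the admissibility-based semantics the witness is `refSet`. For stage semantics nothing has
to be defended, so inner literals are available without `phi` and enlarge the range; the witness is
`falseSet`. -/
theorem exists_extension_of_refuted (h : Encodes F XY Z m C) (hτ : Refuted XY m C τ)
    (σ : Semantics) : ∃ S, F.IsExtension σ S ∧ phi ∉ S ∧ AgreesOn XY S τ := by
  cases σ with
  | preferred =>
    refine ⟨_, ⟨h.refSet_admissible (τ := τ), ?_⟩, id, refSet_agreesOn⟩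
    rintro ⟨S, hS, hsub⟩
    refine hsub.2 (h.subset_refSet hτ hS fun v b hv => ⟨fun hb => ?_, ?_⟩)
    · by_contra hne
      have hb' : τ v = !b := by cases b <;> cases h : τ v <;> simp_all
      exact (h.conflictFree_iff.1 hS.1).2.2.2.1 v b hb (hsub.1 ⟨hv, hb'.symm⟩)
    · rintro rfl
      exact hsub.1 ⟨hv, rfl⟩
  | semiStable =>
    refine ⟨_, ⟨h.refSet_admissible (τ := τ), ?_⟩, id, refSet_agreesOn⟩
    rintro ⟨S, hS, hr⟩
    have ha := AgreesOn.of_range_subset h h.refSet_admissible.1 hS.1 refSet_agreesOn hr.1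
    have hsub := h.subset_refSet hτ hS ha
    exact hr.2 (Set.union_subset_union hsub fun a ⟨b, hb, hr⟩ => ⟨b, hsub hb, hr⟩)
  | stage =>
    refine ⟨_, ⟨h.falseSet_conflictFree (τ := τ), ?_⟩, hτ τ fun _ _ => rfl, falseSet_agreesOn⟩
    rintro ⟨S, hS, hr⟩
    have ha := AgreesOn.of_range_subset h h.falseSet_conflictFree hS falseSet_agreesOn hr.1
    -- A competitor with `phi` contains no clause, yet its range contains all of them; so its
    -- literals satisfy every clause, contrary to `hτ`.
    by_cases hphi : phi ∈ S
    · obtain ⟨τ', ht, hl⟩ := h.exists_assignment hS ha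
      refine hτ τ' ht fun i hi => ?_
      have h1 : cl i ∈ F.range (falseSet XY Z m C τ) := by
        rw [h.cl_mem_range hi]
        by_cases hf : ∀ v b, C i v b → b = !τ v
        · exact .inl ⟨hi, hf⟩
        · push Not at hf
          obtain ⟨v, b, hC, hb⟩ := hf
          exact .inr ⟨v, b, ⟨h.closed i v b hi hC,
            by cases b <;> cases h : τ v <;> simp_all⟩, hC⟩
      rcases (h.cl_mem_range hi).1 (hr.1 h1) with h2 | ⟨v, b, hv, hC⟩
      · exact ((h.conflictFree_iff.1 hS).2.2.2.2.2 hphi i h2).elim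
      · exact ⟨v, hl v b hv ▸ hC⟩
    · exact hr.2 (h.range_subset_falseSet hS (fun v b hv => (ha v b hv).1) hphi)

/-! ### Properties of all extensions -/

/-- An outer literal is attacked only by its complement, and attacks this in return. It cannot
conflict with a clause in `S`, since the clause would need the complement in `S` as defender. -/
theorem insert_lit_admissible (h : Encodes F XY Z m C) (hS : F.Admissible S) {v : V}
    (hv : XY v) (hn : ∀ b, lit v b ∉ S) (b : Bool) : F.Admissible (insert (lit v b) S) := by
  rw [h.admissible_iff, h.conflictFree_iff] at hS ⊢
  obtain ⟨⟨h0, h1, h2, h3, h4, h5⟩, h6, h7, h8⟩ := hS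
  refine ⟨⟨Set.insert_subset ((h.args_lit v b).2 (.inl hv)) h0, by simpa using h1,
    by simpa using h2, ?_, ?_, by simpa using h5⟩, ?_, ?_, ?_⟩
  · rintro w c (hw | hw) (hw' | hw')
    · rw [Arg.lit.injEq] at hw hw'
      have := hw.2.trans hw'.2.symm
      cases c <;> simp at this
    · rw [Arg.lit.injEq] at hw
      exact hn _ (hw.1 ▸ hw')
    · rw [Arg.lit.injEq] at hw'
      exact hn _ (hw'.1 ▸ hw)
    · exact h3 w c hw hw'
  · rintro i w c (hi | hi) hC (hw | hw)
    · cases hi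
    · cases hi
    · rw [Arg.lit.injEq] at hw
      exact hn _ (hw.1 ▸ h7 i w c hi hC)
    · exact h4 i w c hi hC hw
  · rintro w c hZ (hw | hw)
    · rw [Arg.lit.injEq] at hw
      exact (h.disj v hv (hw.1 ▸ hZ)).elim
    · exact .inr (h6 w c hZ hw)
  · rintro i w c (hi | hi) hC
    · cases hi
    · exact .inr (h7 i w c hi hC)
  · rintro (hp | hp) i hi
    · cases hp
    · obtain ⟨w, c, hC, hw⟩ := h8 hp i hi
      exact ⟨w, c, hC, .inr hw⟩

theorem insert_top_admissible (h : Encodes F XY Z m C) (hS : F.Admissible S) :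
    F.Admissible (insert top S) := by
  rw [h.admissible_iff, h.conflictFree_iff] at hS ⊢
  simpa [Set.insert_subset_iff, h.args_top] using hS

theorem agreesOn_of_total (h : Encodes F XY Z m C) (hS : F.ConflictFree S)
    (ht : ∀ v, XY v → ∃ b, lit v b ∈ S) : ∃ τ, AgreesOn XY S τ := by
  classical
  have hl := (h.conflictFree_iff.1 hS).2.2.2.1
  refine ⟨fun v => decide (lit v true ∈ S), fun v b hv => ?_⟩
  obtain ⟨c, hc⟩ := ht v hv
  have := hl v _ hc
  cases b <;> cases c <;> simp_all

theorem top_mem_and_agreesOn (h : Encodes F XY Z m C) (σ : Semantics)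
    (hS : F.IsExtension σ S) : top ∈ S ∧ ∃ τ, AgreesOn XY S τ := by
  cases σ with
  | preferred =>
    refine ⟨?_, h.agreesOn_of_total hS.1.1 ?_⟩
    · by_contra ht
      exact hS.2 ⟨_, h.insert_top_admissible hS.1, Set.ssubset_insert ht⟩
    · by_contra! hc
      obtain ⟨v, hv, hn⟩ := hc
      exact hS.2 ⟨_, h.insert_lit_admissible hS.1 hv hn true, Set.ssubset_insert (hn true)⟩
  | semiStable =>
    have hsub : ∀ a, F.range S ⊆ F.range (insert a S) := fun a =>
      Set.union_subset_union (Set.subset_insert a S) fun x ⟨b, hb, hr⟩ => ⟨b, .inr hb, hr⟩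
    refine ⟨?_, h.agreesOn_of_total hS.1.1 ?_⟩
    · by_contra ht
      refine hS.2 ⟨_, h.insert_top_admissible hS.1, hsub top, fun hr => ht ?_⟩
      exact h.top_mem_range.1 (hr (.inl (Set.mem_insert _ _)))
    · by_contra! hc
      obtain ⟨v, hv, hn⟩ := hc
      have hadm := h.insert_lit_admissible hS.1 hv hn true
      refine hS.2 ⟨_, hadm, hsub _, fun hr => hn true ?_⟩
      rw [← h.dl_mem_range hS.1.1 _ hv]
      exact hr ((h.dl_mem_range hadm.1 _ hv).2 (Set.mem_insert _ _))
  | stage =>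
    classical
    have hl := (h.conflictFree_iff.1 hS.1).2.2.2.1
    set τ : V → Bool := fun v => decide (lit v true ∈ S) with hτ
    have hSτ : ∀ v b, lit v b ∈ S → b = τ v := by
      intro v b hv
      have := hl v b hv
      cases b <;> simp_all
    -- Complete `S` to `satSet` or `falseSet` for the assignment read off from it. By maximality the
    -- ranges coincide, and the range determines `top` and the outer literals.
    obtain ⟨S', hS', htop, ha, hr⟩ : ∃ S', F.ConflictFree S' ∧ top ∈ S' ∧ AgreesOn XY S' τ ∧
        F.range S ⊆ F.range S' := by
      by_cases hphi : phi ∈ S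
      · refine ⟨_, h.satSet_conflictFree, trivial, satSet_agreesOn, ?_⟩
        have hsub : S ⊆ satSet XY Z τ := by
          obtain ⟨h0, h1, h2, -, -, h5⟩ := h.conflictFree_iff.1 hS.1
          rintro (⟨v, b⟩ | ⟨v, b⟩ | i | _ | _ | _) hx
          exacts [⟨(h.args_lit v b).1 (h0 hx), hSτ v b hx⟩, h1 v b hx, h5 hphi i hx, trivial,
            h2 hx, trivial]
        exact Set.union_subset_union hsub fun a ⟨b, hb, hr⟩ => ⟨b, hsub hb, hr⟩
      · exact ⟨_, h.falseSet_conflictFree, trivial, falseSet_agreesOn,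
          h.range_subset_falseSet hS.1 (fun v b _ => hSτ v b) hphi⟩
    have hr' : F.range S' ⊆ F.range S := by
      by_contra hn
      exact hS.2 ⟨S', hS', hr, hn⟩
    exact ⟨h.top_mem_range.1 (hr' (.inl htop)), τ, AgreesOn.of_range_subset h hS' hS.1 ha hr'⟩

/-- If `τ'` satisfied the clauses, `satSet` for `τ'` would beat `S`: it contains `phi`, and its
range contains `beta`. -/
theorem refuted_of_phi_notMem (h : Encodes F XY Z m C) (σ : Semantics)
    (hS : F.IsExtension σ S) (ha : AgreesOn XY S τ) (hphi : phi ∉ S) : Refuted XY m C τ := by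
  intro τ' ht hτ'
  have ha' : ∀ v b, XY v → lit v b ∈ S → b = τ' v := fun v b hv hb =>
    ((ha v b hv).1 hb).trans (ht v hv).symm
  cases σ with
  | preferred =>
    refine hS.2 ⟨_, h.satSet_admissible hτ', ?_, fun hs => hphi (hs trivial)⟩
    obtain ⟨⟨h0, h1, h2, -, -, -⟩, h6, h7, -⟩ :=
      (h.admissible_iff.trans (and_congr_left' h.conflictFree_iff)).1 hS.1
    have hXY : ∀ v b, lit v b ∈ S → XY v := fun v b hv =>
      ((h.args_lit v b).1 (h0 hv)).resolve_right fun hz => hphi (h6 v b hz hv)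
    rintro (⟨v, b⟩ | ⟨v, b⟩ | i | _ | _ | _) hx
    · exact ⟨.inl (hXY v b hx), ha' v b (hXY v b hx) hx⟩
    · exact (h1 v b hx).elim
    · obtain ⟨v, hv⟩ := hτ' i ((h.args_cl i).1 (h0 hx))
      have h9 := h7 i v _ hx hv
      have := ha' v _ (hXY v _ h9) h9
      cases h : τ' v <;> simp [h] at this
    · trivial
    · exact (h2 hx).elim
    · trivial
  | semiStable =>
    exact hS.2 ⟨_, h.satSet_admissible hτ', h.range_ssubset_satSet hτ' hS.1.1 ha' hphi⟩
  | stage =>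
    exact hS.2 ⟨_, h.satSet_conflictFree, h.range_ssubset_satSet hτ' hS.1 ha' hphi⟩

end Encodes
end ArgTW

/-! ### Numerical names for the arguments and computation of the instance. -/

namespace ArgTW

open Arg Coded

/-! ### Renaming arguments -/

section
variable {α β : Type}

/-- `G` arises from `F` by renaming the arguments by `f`. -/
structure AF.IsRenaming (F : AF α) (G : AF β) (f : α → β) : Prop where
  inj : Function.Injective f
  args : ∀ b, b ∈ G.args ↔ ∃ a ∈ F.args, f a = b
  attacks : ∀ a a', (f a, f a') ∈ G.attacks ↔ (a, a') ∈ F.attacks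

namespace AF.IsRenaming

variable {F : AF α} {G : AF β} {f : α → β}

theorem conflictFree_image (h : F.IsRenaming G f) (S : Set α) :
    G.ConflictFree (f '' S) ↔ F.ConflictFree S := by
  simp only [ConflictFree, Set.forall_mem_image, h.attacks]
  refine and_congr_left' ⟨fun hs a ha => ?_, fun hs => ?_⟩
  · obtain ⟨a', ha', he⟩ := (h.args _).1 (hs (Set.mem_image_of_mem f ha))
    exact h.inj he ▸ ha'
  · rintro _ ⟨a, ha, rfl⟩
    exact (h.args _).2 ⟨a, hs ha, rfl⟩

theorem exists_attack_iff (h : F.IsRenaming G f) (S : Set α) (a : α) :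
    (∃ b ∈ f '' S, (b, f a) ∈ G.attacks) ↔ ∃ b ∈ S, (b, a) ∈ F.attacks := by
  simp only [Set.exists_mem_image, h.attacks]

theorem eq_of_attack (h : F.IsRenaming G f) {b b' : β} (hb : (b, b') ∈ G.attacks) :
    (∃ a, f a = b) ∧ ∃ a, f a = b' := by
  obtain ⟨h1, h2⟩ := G.attacks_sub _ hb
  obtain ⟨a, -, ha⟩ := (h.args _).1 h1
  obtain ⟨a', -, ha'⟩ := (h.args _).1 h2
  exact ⟨⟨a, ha⟩, ⟨a', ha'⟩⟩

theorem admissible_image (h : F.IsRenaming G f) (S : Set α) :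
    G.Admissible (f '' S) ↔ F.Admissible S := by
  simp only [Admissible, h.conflictFree_image, Set.forall_mem_image, Defends]
  refine and_congr_right fun _ => forall₂_congr fun a _ => ⟨fun hd b hb => ?_, fun hd b hb => ?_⟩
  · exact (h.exists_attack_iff S b).1 (hd (f b) ((h.attacks _ _).2 hb))
  · obtain ⟨⟨b, rfl⟩, -⟩ := h.eq_of_attack hb
    exact (h.exists_attack_iff S b).2 (hd b ((h.attacks _ _).1 hb))

theorem range_image (h : F.IsRenaming G f) (S : Set α) :
    G.range (f '' S) = f '' F.range S := by
  rw [AF.range, AF.range, Set.image_union]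
  congr 1
  ext b
  constructor
  · rintro ⟨c, hc, hr⟩
    obtain ⟨-, a, rfl⟩ := h.eq_of_attack hr
    exact ⟨a, (h.exists_attack_iff S a).1 ⟨c, hc, hr⟩, rfl⟩
  · rintro ⟨a, ha, rfl⟩
    exact (h.exists_attack_iff S a).2 ha

theorem exists_eq_image (h : F.IsRenaming G f) {S : Set β} (hS : G.ConflictFree S) :
    ∃ T, S = f '' T := by
  refine ⟨f ⁻¹' S, (Set.image_preimage_eq_of_subset fun b hb => ?_).symm⟩
  obtain ⟨a, -, ha⟩ := (h.args _).1 (hS.1 hb)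
  exact ⟨a, ha⟩

theorem isExtension_image (h : F.IsRenaming G f) (σ : Semantics) (S : Set α) :
    G.IsExtension σ (f '' S) ↔ F.IsExtension σ S := by
  have ss : ∀ A B : Set α, f '' A ⊂ f '' B ↔ A ⊂ B := fun A B =>
    h.inj.injOn.image_ssubset_image_iff (Set.subset_univ A) (Set.subset_univ B)
  -- Competing sets are conflict-free, hence consist of arguments of `G` and are images under `f`.
  have ex : ∀ {P : Set β → Prop}, (∀ S, P S → G.ConflictFree S) →
      ((∃ S, P S) ↔ ∃ T, P (f '' T)) := by
    refine fun {P} hP => ⟨?_, fun ⟨T, hT⟩ => ⟨_, hT⟩⟩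
    rintro ⟨S, hS⟩
    obtain ⟨T, rfl⟩ := h.exists_eq_image (hP S hS)
    exact ⟨T, hS⟩
  cases σ with
  | preferred =>
    refine and_congr (h.admissible_image S) (not_congr ((ex fun _ hS => hS.1.1).trans ?_))
    simp only [h.admissible_image, ss]
  | semiStable =>
    refine and_congr (h.admissible_image S) (not_congr ((ex fun _ hS => hS.1.1).trans ?_))
    simp only [h.admissible_image, h.range_image, ss]
  | stage =>
    refine and_congr (h.conflictFree_image S) (not_congr ((ex fun _ hS => hS.1).trans ?_))
    simp only [h.conflictFree_image, h.range_image, ss]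

theorem isExtension_conflictFree {F : AF α} {σ : Semantics} {S : Set α}
    (hS : F.IsExtension σ S) : F.ConflictFree S := by
  cases σ
  exacts [hS.1.1, hS.1.1, hS.1]

theorem projCredCount_eq (h : F.IsRenaming G f) (σ : Semantics) (P : Set α) (a : α) :
    G.projCredCount σ (f '' P) (f a) = F.projCredCount σ P a := by
  rw [projCredCount, projCredCount, ← Set.ncard_image_of_injective _ h.inj.image_injective]
  congr 1
  ext Q
  constructor
  · rintro ⟨S, hS, ha, rfl⟩
    obtain ⟨T, rfl⟩ := h.exists_eq_image (isExtension_conflictFree hS)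
    refine ⟨T ∩ P, ⟨T, (h.isExtension_image σ T).1 hS, ?_, rfl⟩, Set.image_inter h.inj⟩
    exact (h.inj.mem_set_image).1 ha
  · rintro ⟨_, ⟨T, hT, ha, rfl⟩, rfl⟩
    exact ⟨f '' T, (h.isExtension_image σ T).2 hT, Set.mem_image_of_mem f ha,
      Set.image_inter h.inj⟩

end AF.IsRenaming
end

/-! ### Names of arguments -/

/-- The name of a variable; `none` is a fresh variable. -/
def varName : Option ℕ → ℕ
  | none => 2
  | some u => 2 * u + 1

/-- The number `2 ^ i - 1`, whose binary representation consists of `i` ones. -/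
def onesName : ℕ → ℕ
  | 0 => 0
  | i + 1 => 2 * onesName i + 1

/-- The two lowest bits are a tag: `00` for literals, `01` for markers, `11` for clauses and `10`
for the constants, lowest bit first. As numbers are stored in this order, prefixing a tag is a
matter of `cons` instructions; so is passing to the next clause index, because indices are written
in unary. -/
def Arg.name : Arg (Option ℕ) → ℕ
  | lit v b => Nat.bit false (Nat.bit false (Nat.bit b (varName v)))
  | dl v b => Nat.bit false (Nat.bit true (Nat.bit b (varName v)))
  | cl i => Nat.bit true (Nat.bit true (onesName i))
  | phi => Nat.bit true (Nat.bit false 1)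
  | beta => Nat.bit true (Nat.bit false 2)
  | top => Nat.bit true (Nat.bit false 3)

theorem varName_pos (v : Option ℕ) : varName v ≠ 0 := by cases v <;> simp [varName]

theorem varName_injective : Function.Injective varName := by
  rintro (_ | u) (_ | v) <;> simp [varName]

theorem onesName_injective : Function.Injective onesName := by
  intro i
  induction i with
  | zero => rintro (_ | j) <;> simp [onesName]
  | succ i ih =>
    rintro (_ | j)
    · simp [onesName]
    · intro h
      simp only [onesName] at h
      rw [ih (show onesName i = onesName j by omega)]

theorem Arg.name_injective : Function.Injective Arg.name := by
  have key : ∀ {v w : Option ℕ} {b c : Bool},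
      Nat.bit b (varName v) = Nat.bit c (varName w) → v = w ∧ b = c := by
    intro v w b c h
    simp only [Nat.bit_val] at h
    constructor
    · apply varName_injective
      cases b <;> cases c <;> simp at h <;> omega
    · cases b <;> cases c <;> simp at h ⊢ <;> omega
  rintro (⟨v, b⟩ | ⟨v, b⟩ | i | _ | _ | _) (⟨w, c⟩ | ⟨w, c⟩ | j | _ | _ | _) h
  all_goals
    simp only [Arg.name, Nat.bit_false, Nat.bit_true] at h
    first
    | rfl
    | (exfalso; omega)
    | (obtain ⟨rfl, rfl⟩ := key (by omega : Nat.bit b (varName v) = Nat.bit c (varName w)); rfl)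
    | rw [onesName_injective (by omega : onesName i = onesName j)]

instance : Coded (Option ℕ) := ⟨fun v => encNat (varName v)⟩
instance : Coded (Arg (Option ℕ)) := ⟨fun a => encNat a.name⟩

/-- Natural numbers encoded in unary. -/
structure Unary where
  val : ℕ

instance : Coded Unary := ⟨fun i => encNat (onesName i.val)⟩

/-- The hypothesis excludes `Nat.bit false 0 = 0`, whose code is `nil` and not a pair. This is why
names of variables are nonzero. -/
theorem encNat_bit {n : ℕ} {b : Bool} (h : n = 0 → b = true) :
    encNat (Nat.bit b n) = .cons (encBool b) (encNat n) := by
  rw [encNat, Nat.bits_append_bit n b h]; rfl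

theorem encNat_bit1 (n : ℕ) : encNat (2 * n + 1) = .cons (encBool true) (encNat n) := by
  rw [encNat, Nat.bit1_bits]; rfl

section
variable {γ : Type} [Coded γ]

theorem PolyTime.some {f : γ → ℕ} (hf : PolyTime f) : PolyTime fun x => Option.some (f x) :=
  of_cons (const true) hf fun _ => encNat_bit1 _

theorem PolyTime.succUnary {f : γ → Unary} (hf : PolyTime f) :
    PolyTime fun x => Unary.mk ((f x).val + 1) :=
  of_cons (const true) hf fun _ => encNat_bit1 _

theorem PolyTime.lit {f : γ → Option ℕ} {g : γ → Bool} (hf : PolyTime f) (hg : PolyTime g) :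
    PolyTime fun x => Arg.lit (f x) (g x) := by
  refine of_cons (const false) (of_cons (const false) (hg.pair hf) (h := fun x =>
    Nat.bit false (Nat.bit (g x) (varName (f x)))) fun x => ?_) fun x => ?_
  · refine (encNat_bit fun h => ?_).trans (congrArg _ (encNat_bit fun h => ?_))
    exacts [(varName_pos _ ((Nat.bit_eq_zero_iff.1 h).1)).elim, (varName_pos _ h).elim]
  · refine encNat_bit fun h => ?_
    exact (varName_pos _ (Nat.bit_eq_zero_iff.1 (Nat.bit_eq_zero_iff.1 h).1).1).elim

theorem PolyTime.dl {f : γ → Option ℕ} {g : γ → Bool} (hf : PolyTime f) (hg : PolyTime g) :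
    PolyTime fun x => Arg.dl (f x) (g x) := by
  refine of_cons (const false) (of_cons (const true) (hg.pair hf) (h := fun x =>
    Nat.bit true (Nat.bit (g x) (varName (f x)))) fun x => ?_) fun x => ?_
  · refine (encNat_bit fun h => ?_).trans (congrArg _ (encNat_bit fun h => ?_))
    exacts [(varName_pos _ ((Nat.bit_eq_zero_iff.1 h).1)).elim, (varName_pos _ h).elim]
  · refine encNat_bit fun h => ?_
    exact (varName_pos _ (Nat.bit_eq_zero_iff.1 (Nat.bit_eq_zero_iff.1 h).1).1).elim

theorem PolyTime.cl {f : γ → Unary} (hf : PolyTime f) :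
    PolyTime fun x => (Arg.cl (f x).val : Arg (Option ℕ)) := by
  refine of_cons (const true) (of_cons (const true) hf (h := fun x =>
    Nat.bit true (onesName (f x).val)) fun x => ?_) fun x => ?_
  · exact encNat_bit fun _ => rfl
  · exact encNat_bit fun _ => rfl

end

/-! ### The lists of arguments and attacks -/

abbrev Clause := List (ℕ × Bool)

/-- The three blocks of variables and the clauses. -/
abbrev QBFData := List ℕ × List ℕ × List ℕ × List Clause

def QBF.data (Φ : QBF) : QBFData := (Φ.X, Φ.Y, Φ.Z, Φ.clauses)

/-- The clauses with their indices. -/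
def enumClauses (l : List Clause) : List (Unary × Clause) :=
  (l.foldl (fun s c => (⟨s.1.val + 1⟩, s.2 ++ [(s.1, c)])) ((⟨0⟩ : Unary), [])).2

def outerVars (d : QBFData) : List (Option ℕ) := none :: (d.1 ++ d.2.1).map some

def innerVars (d : QBFData) : List (Option ℕ) := d.2.2.1.map some

def argList (d : QBFData) : List (Arg (Option ℕ)) :=
  (outerVars d ++ innerVars d).flatMap (fun v => [lit v true, lit v false]) ++
    ((outerVars d).flatMap (fun v => [dl v true, dl v false]) ++
      ((enumClauses d.2.2.2).map (fun c => cl c.1.val) ++ [phi, beta, top]))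

/-- The attacks by `lit none true` add the positive fresh literal to every clause. -/
def attackList (d : QBFData) : List (Arg (Option ℕ) × Arg (Option ℕ)) :=
  (outerVars d ++ innerVars d).flatMap
      (fun v => [(lit v false, lit v true), (lit v true, lit v false)]) ++
    ((outerVars d).flatMap (fun v => [(lit v true, dl v true), (dl v true, dl v true),
        (lit v false, dl v false), (dl v false, dl v false)]) ++
      ((innerVars d).flatMap (fun v => [(beta, lit v true), (beta, lit v false)]) ++
        ((enumClauses d.2.2.2).flatMap (fun c => (cl c.1.val, phi) ::
            (lit none true, cl c.1.val) ::
              c.2.map fun l => (lit (some l.1) l.2, cl c.1.val)) ++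
          [(phi, beta), (beta, beta)])))

/-- The literals of `Y` and of the fresh variable are omitted, so that a projection is counted as
soon as one choice for them works. -/
def projList (d : QBFData) : List (Arg (Option ℕ)) :=
  phi :: d.1.flatMap fun v => [lit (some v) true, lit (some v) false]

def reduction (d : QBFData) :
    (List (Arg (Option ℕ)) × List (Arg (Option ℕ) × Arg (Option ℕ))) ×
      List (Arg (Option ℕ)) × Arg (Option ℕ) :=
  ((argList d, attackList d), projList d, top)

theorem foldl_enum_eq (l : List Clause) (i : ℕ) (acc : List (Unary × Clause)) :
    l.foldl (fun s c => ((⟨s.1.val + 1⟩ : Unary), s.2 ++ [(s.1, c)])) (⟨i⟩, acc) =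
      (⟨i + l.length⟩, acc ++ (l.zipIdx i).map fun c => (⟨c.2⟩, c.1)) := by
  induction l generalizing i acc with
  | nil => simp
  | cons c l ih => simp [ih, Nat.add_assoc, Nat.add_comm 1]

theorem enumClauses_eq (l : List Clause) :
    enumClauses l = l.zipIdx.map fun c => (⟨c.2⟩, c.1) := by
  simp [enumClauses, foldl_enum_eq]

theorem mem_enumClauses {l : List Clause} {c : Unary × Clause} :
    c ∈ enumClauses l ↔ l[c.1.val]? = some c.2 := by
  obtain ⟨⟨i⟩, c⟩ := c
  simp [enumClauses_eq, List.mk_mem_zipIdx_iff_getElem?]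

theorem nodup_enumClauses (l : List Clause) : ((enumClauses l).map fun c => c.1.val).Nodup := by
  rw [enumClauses_eq, List.map_map]
  have : (fun c : Unary × Clause => c.1.val) ∘ (fun c : Clause × ℕ => ((⟨c.2⟩ : Unary), c.1)) =
      Prod.snd := rfl
  rw [this, List.zipIdx_map_snd]
  exact List.nodup_range'

theorem codeSize_unary (i : ℕ) : codeSize (Unary.mk i) = 4 * i + 1 := by
  induction i with
  | zero => simp [codeSize, code, onesName, encNat, encList, Data.size]
  | succ i ih =>
    have : codeSize (Unary.mk (i + 1)) = codeSize true + codeSize (Unary.mk i) + 1 := by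
      simp only [codeSize, code, onesName, encNat_bit1]
      rfl
    rw [this, ih]
    simp [codeSize, code, encBool, Data.size]
    omega

theorem polyTime_enumClauses : PolyTime enumClauses := by
  have h := PolyTime.foldl (α := Clause) (β := Unary × List (Unary × Clause))
    (step := fun p => (⟨p.1.1.val + 1⟩, p.1.2 ++ [(p.1.1, p.2)]))
    ((PolyTime.succUnary (.comp .fst .fst)).pair (.append (.comp .snd .fst)
      (.cons (.pair (.comp .fst .fst) .snd) (.const []))))
    -- The summands bound the counter, the old accumulator, and at most `n` new entries of size at
    -- most `6 * n + 2`.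
    (S := fun n => (5 * n + 1) + (n + (n * (6 * n + 3) + 1)) + 1)
    (((((PolyBounded.const 5).mul .id).add (.const 1)).add (PolyBounded.id.add
      ((PolyBounded.id.mul (((PolyBounded.const 6).mul .id).add (.const 3))).add
        (.const 1)))).add (.const 1)) (by
      rintro ⟨⟨i⟩, acc⟩ l
      rw [foldl_enum_eq]
      set n := codeSize (((⟨i⟩ : Unary), acc), l) with hn
      have hlen := length_lt_codeSize l
      simp only [codeSize_pair, codeSize_unary] at hn ⊢
      have h1 := codeSize_append acc ((l.zipIdx i).map fun c => ((⟨c.2⟩ : Unary), c.1))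
      have h2 : codeSize ((l.zipIdx i).map fun c => ((⟨c.2⟩ : Unary), c.1)) ≤
          l.length * (6 * n + 2 + 1) + 1 := by
        refine (codeSize_le_of_forall (M := 6 * n + 2) ?_).trans (by simp)
        intro a ha
        obtain ⟨⟨c, j⟩, hc, rfl⟩ := List.mem_map.1 ha
        have h3 := codeSize_lt_of_mem (List.fst_mem_of_mem_zipIdx hc)
        have h4 := List.snd_lt_add_of_mem_zipIdx hc
        simp only [codeSize_pair, codeSize_unary] at h3 h4 ⊢
        omega
      have h3 : l.length * (6 * n + 2 + 1) ≤ n * (6 * n + 3) :=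
        Nat.mul_le_mul (by omega) le_rfl
      omega)
  have h0 : PolyTime fun l : List Clause =>
      (((⟨0⟩ : Unary), ([] : List (Unary × Clause))), l) := (PolyTime.const _).pair .id
  have h1 := h.comp h0
  have h2 := PolyTime.snd.comp h1
  exact h2

open PolyTime in
theorem polyTime_reduction : PolyTime reduction := by
  have hX : PolyTime fun d : QBFData => d.1 := fst
  have hY : PolyTime fun d : QBFData => d.2.1 := fst.comp snd
  have hZ : PolyTime fun d : QBFData => d.2.2.1 := fst.comp (snd.comp snd)
  have hC : PolyTime fun d : QBFData => enumClauses d.2.2.2 :=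
    polyTime_enumClauses.comp (snd.comp (snd.comp snd))
  have hout : PolyTime outerVars := (const none).cons (map (f := fun p : QBFData × ℕ => some p.2)
    (PolyTime.some snd) (hX.append hY))
  have hin : PolyTime innerVars := map (f := fun p : QBFData × ℕ => some p.2)
    (PolyTime.some snd) hZ
  have hv : PolyTime fun p : QBFData × Option ℕ => p.2 := snd
  have lt := hv.lit (const true)
  have lf := hv.lit (const false)
  have dt := hv.dl (const true)
  have df := hv.dl (const false)
  have hi : PolyTime fun p : QBFData × (Unary × Clause) => (cl p.2.1.val : Arg (Option ℕ)) :=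
    PolyTime.cl (fst.comp snd)
  have hA : PolyTime argList := by
    refine .append (flatMap (f := fun p : QBFData × Option ℕ => [lit p.2 true, lit p.2 false])
      (lt.cons (lf.cons (const []))) (hout.append hin)) (.append
      (flatMap (f := fun p : QBFData × Option ℕ => [dl p.2 true, dl p.2 false])
      (dt.cons (df.cons (const []))) hout) (.append (map (f := fun p : QBFData × (Unary × Clause) =>
        (cl p.2.1.val : Arg (Option ℕ))) hi hC) (const _)))
  have hR : PolyTime attackList := by
    refine .append (flatMap (f := fun p : QBFData × Option ℕ =>
        [(lit p.2 false, lit p.2 true), (lit p.2 true, lit p.2 false)])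
        ((lf.pair lt).cons ((lt.pair lf).cons (const []))) (hout.append hin)) (.append
      (flatMap (f := fun p : QBFData × Option ℕ => [(lit p.2 true, dl p.2 true),
        (dl p.2 true, dl p.2 true), (lit p.2 false, dl p.2 false), (dl p.2 false, dl p.2 false)])
        ((lt.pair dt).cons ((dt.pair dt).cons ((lf.pair df).cons ((df.pair df).cons (const [])))))
        hout) (.append
      (flatMap (f := fun p : QBFData × Option ℕ => [(beta, lit p.2 true), (beta, lit p.2 false)])
        (((const beta).pair lt).cons (((const beta).pair lf).cons (const []))) hin) (.append
      (flatMap (f := fun p : QBFData × (Unary × Clause) => (cl p.2.1.val, phi) ::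
        (lit none true, cl p.2.1.val) ::
          p.2.2.map fun l => ((lit (some l.1) l.2 : Arg (Option ℕ)), cl p.2.1.val))
        ((hi.pair (const phi)).cons (((const (lit none true)).pair hi).cons
          (map (f := fun q : (QBFData × (Unary × Clause)) × (ℕ × Bool) =>
            ((lit (some q.2.1) q.2.2 : Arg (Option ℕ)), (cl q.1.2.1.val : Arg (Option ℕ))))
            ((PolyTime.lit (PolyTime.some (fst.comp snd)) (snd.comp snd)).pair (hi.comp fst))
            (snd.comp snd)))) hC) (const _))))
  have hP : PolyTime projList := (const phi).cons
    (flatMap (f := fun p : QBFData × ℕ => [lit (some p.2) true, lit (some p.2) false])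
      ((PolyTime.lit (PolyTime.some snd) (const true)).cons
        ((PolyTime.lit (PolyTime.some snd) (const false)).cons (const []))) hX)
  exact (hA.pair hR).pair (hP.pair (const top))

end ArgTW

/-! ### Correctness of the reduction: truth of the formula in terms of the count. -/

namespace ArgTW

open Arg Coded

/-! ### The instance of the counting problem -/

theorem nodup_flatMap_of_disjoint {α β : Type} {l : List α} {f : α → List β} (hl : l.Nodup)
    (hf : ∀ a ∈ l, (f a).Nodup)
    (hd : ∀ a ∈ l, ∀ a' ∈ l, ∀ b ∈ f a, b ∈ f a' → a = a') : (l.flatMap f).Nodup := by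
  rw [List.nodup_flatMap]
  refine ⟨hf, hl.imp_of_mem fun {a a'} ha ha' hne b hb hb' => hne (hd a ha a' ha' b hb hb')⟩

namespace QBF

variable (Φ : QBF)

theorem mem_outerVars {v : Option ℕ} :
    v ∈ outerVars Φ.data ↔ v = none ∨ ∃ u, (u ∈ Φ.X ∨ u ∈ Φ.Y) ∧ v = some u := by
  simp [outerVars, QBF.data, eq_comm, or_and_right, exists_or]

theorem mem_innerVars {v : Option ℕ} : v ∈ innerVars Φ.data ↔ ∃ u ∈ Φ.Z, v = some u := by
  simp [innerVars, QBF.data, eq_comm]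

theorem nodup_outerVars_append : (outerVars Φ.data ++ innerVars Φ.data).Nodup := by
  have h : outerVars Φ.data ++ innerVars Φ.data =
      none :: (Φ.X ++ Φ.Y ++ Φ.Z).map some := by
    simp [outerVars, innerVars, QBF.data]
  rw [h, List.nodup_cons]
  exact ⟨by simp, Φ.vars_nodup.map (Option.some_injective _)⟩

theorem nodup_outerVars : (outerVars Φ.data).Nodup :=
  (List.nodup_append'.1 Φ.nodup_outerVars_append).1

theorem nodup_innerVars : (innerVars Φ.data).Nodup :=
  (List.nodup_append'.1 Φ.nodup_outerVars_append).2.1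

theorem nodup_enum : (enumClauses Φ.clauses).Nodup := (nodup_enumClauses Φ.clauses).of_map

theorem enum_inj {c c' : Unary × Clause} (hc : c ∈ enumClauses Φ.clauses)
    (hc' : c' ∈ enumClauses Φ.clauses) (h : c.1.val = c'.1.val) : c = c' := by
  rw [mem_enumClauses] at hc hc'
  rw [h, hc', Option.some.injEq] at hc
  obtain ⟨⟨i⟩, c⟩ := c
  obtain ⟨⟨j⟩, c'⟩ := c'
  simp_all

theorem nodup_argList : (argList Φ.data).Nodup := by
  refine List.nodup_append'.2 ⟨?_, List.nodup_append'.2 ⟨?_, List.nodup_append'.2 ⟨?_, ?_, ?_⟩,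
    ?_⟩, ?_⟩
  · refine nodup_flatMap_of_disjoint Φ.nodup_outerVars_append (by simp) ?_
    intro v _ w _ a ha hb
    simp only [List.mem_cons, List.not_mem_nil, or_false] at ha hb
    rcases ha with rfl | rfl <;> simp_all
  · refine nodup_flatMap_of_disjoint Φ.nodup_outerVars (by simp) ?_
    intro v _ w _ a ha hb
    simp only [List.mem_cons, List.not_mem_nil, or_false] at ha hb
    rcases ha with rfl | rfl <;> simp_all
  · have := (nodup_enumClauses Φ.clauses).map (f := fun i => (cl i : Arg (Option ℕ)))
      fun i j h => by simpa using h
    rwa [List.map_map] at this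
  · simp
  · intro a
    simp only [List.mem_map, List.mem_cons, List.not_mem_nil, or_false]
    rintro ⟨c, -, rfl⟩
    simp
  · intro a
    simp only [List.mem_flatMap, List.mem_append, List.mem_map, List.mem_cons, List.not_mem_nil,
      or_false]
    rintro ⟨v, -, rfl | rfl⟩ <;> simp
  · intro a
    simp only [List.mem_flatMap, List.mem_append, List.mem_map, List.mem_cons, List.not_mem_nil,
      or_false]
    rintro ⟨v, -, rfl | rfl⟩ <;> simp

theorem nodup_attackList : (attackList Φ.data).Nodup := by
  refine List.nodup_append'.2 ⟨?_, List.nodup_append'.2 ⟨?_, List.nodup_append'.2 ⟨?_,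
    List.nodup_append'.2 ⟨?_, ?_, ?_⟩, ?_⟩, ?_⟩, ?_⟩
  · refine nodup_flatMap_of_disjoint Φ.nodup_outerVars_append (by simp) ?_
    intro v _ w _ a ha hb
    simp only [List.mem_cons, List.not_mem_nil, or_false] at ha hb
    rcases ha with rfl | rfl <;> simp_all
  · refine nodup_flatMap_of_disjoint Φ.nodup_outerVars (by simp) ?_
    intro v _ w _ a ha hb
    simp only [List.mem_cons, List.not_mem_nil, or_false] at ha hb
    rcases ha with rfl | rfl | rfl | rfl <;> simp_all
  · refine nodup_flatMap_of_disjoint Φ.nodup_innerVars (by simp) ?_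
    intro v _ w _ a ha hb
    simp only [List.mem_cons, List.not_mem_nil, or_false] at ha hb
    rcases ha with rfl | rfl <;> simp_all
  · refine nodup_flatMap_of_disjoint Φ.nodup_enum (fun c hc => ?_) ?_
    · have hn : c.2.Nodup := Φ.clauses_nodup _ (List.mem_of_getElem? (mem_enumClauses.1 hc))
      simp only [List.nodup_cons, List.mem_cons, List.mem_map, Prod.mk.injEq, reduceCtorEq,
        and_false, exists_false, or_false, not_false_eq_true, true_and, lit.injEq, false_and]
      refine hn.map fun l l' h => ?_
      simpa [Prod.ext_iff] using h
    · intro c hc c' hc' a ha ha'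
      apply Φ.enum_inj hc hc'
      simp only [List.mem_cons, List.mem_map] at ha ha'
      rcases ha with rfl | rfl | ⟨l, -, rfl⟩ <;> rcases ha' with ha' | ha' | ⟨l', -, ha'⟩ <;>
        simp_all
  · simp
  · intro a
    simp only [List.mem_flatMap, List.mem_cons, List.mem_map, List.not_mem_nil, or_false]
    rintro ⟨c, -, rfl | rfl | ⟨l, -, rfl⟩⟩ <;> simp
  · intro a
    simp only [List.mem_flatMap, List.mem_append, List.mem_cons, List.mem_map, List.not_mem_nil,
      or_false]
    rintro ⟨v, -, rfl | rfl⟩ <;> simp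
  · intro a
    simp only [List.mem_flatMap, List.mem_append, List.mem_cons, List.mem_map, List.not_mem_nil,
      or_false]
    rintro ⟨v, -, rfl | rfl | rfl | rfl⟩ <;> simp
  · intro a
    simp only [List.mem_flatMap, List.mem_append, List.mem_cons, List.mem_map, List.not_mem_nil,
      or_false]
    rintro ⟨v, -, rfl | rfl⟩ <;> simp

theorem nodup_projList : (projList Φ.data).Nodup := by
  refine List.nodup_cons.2 ⟨by simp, nodup_flatMap_of_disjoint ?_ (by simp) ?_⟩
  · exact (List.nodup_append'.1 (List.nodup_append'.1 Φ.vars_nodup).1).1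
  · intro v _ w _ a ha hb
    simp only [List.mem_cons, List.not_mem_nil, or_false] at ha hb
    rcases ha with rfl | rfl <;> simp_all

/-! ### Members of the lists -/

/-- The variable `v` belongs to the outer blocks; the fresh variable is universal. -/
def IsOuter (v : Option ℕ) : Prop := v ∈ outerVars Φ.data

def IsInner (v : Option ℕ) : Prop := v ∈ innerVars Φ.data

/-- The literal `(v, b)` belongs to the clause number `i`, to which the fresh variable is added. -/
def ClauseHas (i : ℕ) (v : Option ℕ) (b : Bool) : Prop :=
  (v = none ∧ b = true) ∨ ∃ c ∈ Φ.clauses[i]?, ∃ u, v = some u ∧ (u, b) ∈ c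

theorem exists_enum_iff {P : ℕ → Clause → Prop} :
    (∃ c ∈ enumClauses Φ.clauses, P c.1.val c.2) ↔ ∃ i, ∃ c ∈ Φ.clauses[i]?, P i c := by
  constructor
  · rintro ⟨⟨⟨i⟩, c⟩, hc, hP⟩
    exact ⟨i, c, mem_enumClauses.1 hc, hP⟩
  · rintro ⟨i, c, hc, hP⟩
    exact ⟨(⟨i⟩, c), mem_enumClauses.2 hc, hP⟩

theorem exists_mem_getElem?_iff {i : ℕ} : (∃ c, c ∈ Φ.clauses[i]?) ↔ i < Φ.clauses.length :=
  ⟨fun ⟨_, hc⟩ => (List.getElem?_eq_some_iff.1 hc).1, fun h => ⟨_, List.getElem?_eq_getElem h⟩⟩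

theorem mem_argList {a : Arg (Option ℕ)} : a ∈ argList Φ.data ↔
    (∃ v b, (Φ.IsOuter v ∨ Φ.IsInner v) ∧ a = lit v b) ∨ (∃ v b, Φ.IsOuter v ∧ a = dl v b) ∨
      (∃ i < Φ.clauses.length, a = cl i) ∨ a = phi ∨ a = beta ∨ a = top := by
  have h : (∃ c ∈ enumClauses Φ.clauses, cl c.1.val = a) ↔ ∃ i < Φ.clauses.length, a = cl i := by
    rw [Φ.exists_enum_iff (P := fun i _ => cl i = a)]
    simp only [← exists_mem_getElem?_iff, eq_comm (a := a)]
    exact exists_congr fun i => ⟨fun ⟨c, hc, h⟩ => ⟨⟨c, hc⟩, h⟩, fun ⟨⟨c, hc⟩, h⟩ => ⟨c, hc, h⟩⟩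
  rw [argList, show Φ.data.2.2.2 = Φ.clauses from rfl]
  simp only [List.mem_append, List.mem_flatMap, List.mem_map, h, Bool.exists_bool,
    List.mem_cons, List.not_mem_nil, or_false, IsOuter, IsInner]
  refine or_congr (exists_congr fun v => ?_) (or_congr (exists_congr fun v => ?_) Iff.rfl) <;>
    tauto

theorem mem_attackList {a b : Arg (Option ℕ)} : (a, b) ∈ attackList Φ.data ↔
    (∃ v c, (Φ.IsOuter v ∨ Φ.IsInner v) ∧ a = lit v (!c) ∧ b = lit v c) ∨
    (∃ v c, Φ.IsOuter v ∧ (a = lit v c ∨ a = dl v c) ∧ b = dl v c) ∨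
    (∃ v c, Φ.IsInner v ∧ a = beta ∧ b = lit v c) ∨
    (∃ i < Φ.clauses.length, a = cl i ∧ b = phi) ∨
    (∃ i < Φ.clauses.length, b = cl i ∧ ∃ v c, a = lit v c ∧ Φ.ClauseHas i v c) ∨
    ((a = phi ∨ a = beta) ∧ b = beta) := by
  have h : (∃ c ∈ enumClauses Φ.clauses, (a, b) ∈ (cl c.1.val, phi) ::
      (lit none true, cl c.1.val) :: c.2.map fun l => ((lit (some l.1) l.2 : Arg (Option ℕ)),
        cl c.1.val)) ↔
      (∃ i < Φ.clauses.length, a = cl i ∧ b = phi) ∨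
      (∃ i < Φ.clauses.length, b = cl i ∧ ∃ v c, a = lit v c ∧ Φ.ClauseHas i v c) := by
    rw [Φ.exists_enum_iff (P := fun i c => (a, b) ∈ (cl i, phi) ::
      (lit none true, cl i) :: c.map fun l => ((lit (some l.1) l.2 : Arg (Option ℕ)), cl i))]
    simp only [List.mem_cons, List.mem_map, Prod.mk.injEq, ← exists_mem_getElem?_iff]
    constructor
    · rintro ⟨i, c, hc, ⟨rfl, rfl⟩ | ⟨rfl, rfl⟩ | ⟨⟨u, d⟩, hl, rfl, rfl⟩⟩
      · exact .inl ⟨i, ⟨c, hc⟩, rfl, rfl⟩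
      · exact .inr ⟨i, ⟨c, hc⟩, rfl, none, true, rfl, .inl ⟨rfl, rfl⟩⟩
      · exact .inr ⟨i, ⟨c, hc⟩, rfl, some u, d, rfl, .inr ⟨c, hc, u, rfl, hl⟩⟩
    · rintro (⟨i, ⟨c, hc⟩, rfl, rfl⟩ | ⟨i, ⟨c, hc⟩, rfl, v, d, rfl, ⟨rfl, rfl⟩ |
        ⟨c', hc', u, rfl, hl⟩⟩)
      · exact ⟨i, c, hc, .inl ⟨rfl, rfl⟩⟩
      · exact ⟨i, c, hc, .inr (.inl ⟨rfl, rfl⟩)⟩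
      · exact ⟨i, c', hc', .inr (.inr ⟨(u, d), hl, rfl, rfl⟩)⟩
  rw [attackList, show Φ.data.2.2.2 = Φ.clauses from rfl]
  simp only [List.mem_append, List.mem_flatMap]
  rw [h]
  simp only [Bool.exists_bool, Bool.not_true, Bool.not_false,
    List.mem_cons, List.not_mem_nil, or_false, IsOuter, IsInner, Prod.mk.injEq, or_assoc]
  refine or_congr (exists_congr fun v => ?_) (or_congr (exists_congr fun v => ?_)
    (or_congr (exists_congr fun v => ?_) (or_congr Iff.rfl (or_congr Iff.rfl ?_)))) <;>
    tauto

theorem mem_projList {a : Arg (Option ℕ)} : a ∈ projList Φ.data ↔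
    a = phi ∨ ∃ u b, u ∈ Φ.X ∧ a = lit (some u) b := by
  rw [projList, show Φ.data.1 = Φ.X from rfl]
  simp only [List.mem_cons, List.mem_flatMap, List.not_mem_nil, or_false, Bool.exists_bool]
  refine or_congr Iff.rfl (exists_congr fun v => ?_)
  tauto

theorem closed_clauseHas {i : ℕ} {v : Option ℕ} {b : Bool} (h : Φ.ClauseHas i v b) :
    Φ.IsOuter v ∨ Φ.IsInner v := by
  rcases h with ⟨rfl, -⟩ | ⟨c, hc, u, rfl, hl⟩
  · exact .inl (Φ.mem_outerVars.2 (.inl rfl))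
  · have := Φ.closed c (List.mem_of_getElem? hc) _ hl
    rw [List.mem_append, List.mem_append] at this
    exact this.imp (fun hu => Φ.mem_outerVars.2 (.inr ⟨u, hu, rfl⟩))
      fun hu => Φ.mem_innerVars.2 ⟨u, hu, rfl⟩

theorem attackList_subset {a b : Arg (Option ℕ)} (h : (a, b) ∈ attackList Φ.data) :
    a ∈ argList Φ.data ∧ b ∈ argList Φ.data := by
  rw [mem_attackList] at h
  rw [mem_argList, mem_argList]
  rcases h with ⟨v, c, hv, rfl, rfl⟩ | ⟨v, c, hv, rfl | rfl, rfl⟩ | ⟨v, c, hv, rfl, rfl⟩ |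
    ⟨i, hi, rfl, rfl⟩ | ⟨i, hi, rfl, v, c, rfl, hC⟩ | ⟨rfl | rfl, rfl⟩
  · simp [hv]
  · simp [hv]
  · simp [hv]
  · simp [hv]
  · simp [hi]
  · simp [hi, Φ.closed_clauseHas hC]
  · simp
  · simp

/-! ### The framework -/

open Classical in
noncomputable def argFramework : AF (Arg (Option ℕ)) where
  args := (argList Φ.data).toFinset
  nonempty := ⟨phi, by simp [mem_argList]⟩
  attacks := (attackList Φ.data).toFinset
  attacks_sub := fun e he => by
    simpa using Φ.attackList_subset (List.mem_toFinset.1 he)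

theorem encodes : Encodes Φ.argFramework Φ.IsOuter Φ.IsInner Φ.clauses.length Φ.ClauseHas where
  disj := fun v h1 h2 => (List.nodup_append'.1 Φ.nodup_outerVars_append).2.2 h1 h2
  closed := fun i v b _ h => Φ.closed_clauseHas h
  args_lit := fun v b => by simp [argFramework, mem_argList]
  args_dl := fun v b => by simp [argFramework, mem_argList]
  args_cl := fun i => by simp [argFramework, mem_argList]
  args_phi := by simp [argFramework, mem_argList]
  args_beta := by simp [argFramework, mem_argList]
  args_top := by simp [argFramework, mem_argList]
  att_lit := fun a v b => by
    simp only [argFramework, List.mem_toFinset, mem_attackList, reduceCtorEq, and_false,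
      exists_false, false_and, or_false, false_or, lit.injEq]
    refine or_congr ⟨?_, fun ⟨h1, h2⟩ => ⟨v, b, h2, h1, rfl, rfl⟩⟩
      ⟨?_, fun ⟨h1, h2⟩ => ⟨v, b, h2, h1, rfl, rfl⟩⟩
    · rintro ⟨v, b, h2, h1, rfl, rfl⟩
      exact ⟨h1, h2⟩
    · rintro ⟨v, b, h2, h1, rfl, rfl⟩
      exact ⟨h1, h2⟩
  att_dl := fun a v b => by
    simp only [argFramework, List.mem_toFinset, mem_attackList, reduceCtorEq, and_false,
      exists_false, false_and, or_false, false_or, dl.injEq]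
    refine ⟨?_, fun ⟨h1, h2⟩ => ⟨v, b, h1, h2, rfl, rfl⟩⟩
    rintro ⟨v, b, h1, h2, rfl, rfl⟩
    exact ⟨h1, h2⟩
  att_cl := fun a i => by
    simp only [argFramework, List.mem_toFinset, mem_attackList, reduceCtorEq, and_false,
      exists_false, or_false, false_or, cl.injEq]
    refine ⟨?_, fun ⟨h1, h2⟩ => ⟨i, h1, rfl, h2⟩⟩
    rintro ⟨i, h1, rfl, h2⟩
    exact ⟨h1, h2⟩
  att_phi := fun a => by
    simp [argFramework, mem_attackList]
  att_beta := fun a => by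
    simp [argFramework, mem_attackList]
  att_top := fun a => by
    simp [argFramework, mem_attackList]

/-- The instance of the counting problem for `Φ`. -/
def toInput : PCredInput where
  args := (argList Φ.data).map Arg.name
  attacks := (attackList Φ.data).map (Prod.map Arg.name Arg.name)
  proj := (projList Φ.data).map Arg.name
  query := top.name
  args_nodup := Φ.nodup_argList.map Arg.name_injective
  attacks_nodup := Φ.nodup_attackList.map (Arg.name_injective.prodMap Arg.name_injective)
  proj_nodup := Φ.nodup_projList.map Arg.name_injective
  attacks_sub := fun e he => by
    obtain ⟨⟨a, b⟩, hab, rfl⟩ := List.mem_map.1 he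
    exact (Φ.attackList_subset hab).imp (List.mem_map_of_mem) (List.mem_map_of_mem)
  proj_sub := fun a ha => by
    obtain ⟨x, hx, rfl⟩ := List.mem_map.1 ha
    refine List.mem_map_of_mem (Φ.mem_argList.2 ?_)
    rcases Φ.mem_projList.1 hx with rfl | ⟨u, b, hu, rfl⟩
    · simp
    · exact .inl ⟨_, _, .inl (Φ.mem_outerVars.2 (.inr ⟨u, .inl hu, rfl⟩)), rfl⟩
  query_mem := List.mem_map_of_mem (by simp [mem_argList])

theorem isRenaming : Φ.argFramework.IsRenaming Φ.toInput.framework Arg.name where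
  inj := Arg.name_injective
  args := fun b => by simp [toInput, PCredInput.framework, argFramework]
  attacks := fun a a' => by
    simp only [PCredInput.framework, toInput, argFramework, List.mem_toFinset]
    exact List.mem_map_of_injective (Arg.name_injective.prodMap Arg.name_injective)
      (a := (a, a'))

theorem count_toInput (σ : Semantics) : Φ.toInput.count σ =
    Φ.argFramework.projCredCount σ {a | a ∈ projList Φ.data} top := by
  rw [← Φ.isRenaming.projCredCount_eq, PCredInput.count]
  congr 1
  ext a
  simp [toInput]

theorem encList_map {α β : Type} (e : β → Data) (f : α → β) (l : List α) :
    encList e (l.map f) = encList (fun a => e (f a)) l := by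
  induction l with
  | nil => rfl
  | cons a l ih => simp [encList, ih]

/-- The program for `reduction` thus produces exactly the input that the counting program expects.
-/
theorem enc_toInput : Φ.toInput.enc = code (reduction Φ.data) := by
  simp only [PCredInput.enc, PCredInput.encFramework, toInput, encList_map]
  rfl

theorem enc_eq : Φ.enc = code Φ.data := rfl

/-! ### The count -/

/-- The possible projections: an assignment of the variables in `X`, with or without `phi`. -/
def projSet (x : ({u // u ∈ Φ.X} → Bool) × Bool) : Set (Arg (Option ℕ))
  | lit (some u) b => ∃ h : u ∈ Φ.X, b = x.1 ⟨u, h⟩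
  | phi => x.2 = true
  | _ => False

theorem projSet_injective : Function.Injective Φ.projSet := by
  rintro ⟨x, p⟩ ⟨y, q⟩ h
  have hp : (p = true) = (q = true) := congrFun h phi
  have hx : x = y := by
    funext ⟨u, hu⟩
    have h1 : (∃ h : u ∈ Φ.X, x ⟨u, hu⟩ = x ⟨u, h⟩) = ∃ h : u ∈ Φ.X, x ⟨u, hu⟩ = y ⟨u, h⟩ :=
      congrFun h (lit (some u) (x ⟨u, hu⟩))
    obtain ⟨_, h2⟩ := h1.mp ⟨hu, rfl⟩
    exact h2
  have hpq : p = q := Bool.eq_iff_iff.2 (iff_of_eq hp)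
  rw [hx, hpq]

theorem card_projSet : (Set.range Φ.projSet).ncard = 2 ^ (Φ.X.length + 1) := by
  have hX : Φ.X.Nodup := (List.nodup_append'.1 (List.nodup_append'.1 Φ.vars_nodup).1).1
  have h1 : Nat.card {u // u ∈ Φ.X} = Φ.X.length := by
    rw [← List.toFinset_card_of_nodup hX]
    exact Nat.subtype_card Φ.X.toFinset (by simp)
  have : Finite {u // u ∈ Φ.X} := inferInstance
  rw [← Set.image_univ, Set.ncard_image_of_injective _ Φ.projSet_injective, Set.ncard_univ,
    Nat.card_prod, Nat.card_fun, h1]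
  simp [pow_succ]

theorem inter_projList {S : Set (Arg (Option ℕ))} {x : ({u // u ∈ Φ.X} → Bool) × Bool}
    (hx : ∀ u b (h : u ∈ Φ.X), lit (some u) b ∈ S ↔ b = x.1 ⟨u, h⟩)
    (hphi : phi ∈ S ↔ x.2 = true) :
    S ∩ {a | a ∈ projList Φ.data} = Φ.projSet x := by
  ext a
  rw [Set.mem_inter_iff, Set.mem_ofPred_eq, mem_projList]
  rcases a with (⟨_ | u, b⟩ | ⟨v, b⟩ | i | _ | _ | _)
  · simp only [reduceCtorEq, lit.injEq, false_and, and_false, exists_false, or_false, false_iff]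
    exact id
  · simp only [reduceCtorEq, lit.injEq, false_or, Option.some.injEq]
    constructor
    · rintro ⟨hS, w, c, hw, rfl, rfl⟩
      exact ⟨hw, (hx _ _ hw).1 hS⟩
    · rintro ⟨hu, hb⟩
      exact ⟨(hx u b hu).2 hb, u, b, hu, rfl, rfl⟩
  · simp only [reduceCtorEq, and_false, exists_false, or_false, false_iff]
    exact id
  · simp only [reduceCtorEq, and_false, exists_false, or_false, false_iff]
    exact id
  · simp only [true_or, and_true]
    exact hphi
  · simp only [reduceCtorEq, and_false, exists_false, or_false, false_iff]
    exact id
  · simp only [reduceCtorEq, and_false, exists_false, or_false, false_iff]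
    exact id

theorem isOuter_of_mem_X {u : ℕ} (h : u ∈ Φ.X) : Φ.IsOuter (some u) :=
  Φ.mem_outerVars.2 (.inr ⟨u, .inl h, rfl⟩)

theorem isOuter_none : Φ.IsOuter none := Φ.mem_outerVars.2 (.inl rfl)

/-- With the fresh variable true, `phi` is available for every assignment of `X`; with it false, the
clauses are the original ones (`satClauses_iff`). -/
theorem satClauses_of_none {τ : Option ℕ → Bool} (h : τ none = true) :
    SatClauses Φ.clauses.length Φ.ClauseHas τ := fun _ _ => ⟨none, .inl ⟨rfl, h⟩⟩

theorem satClauses_iff {τ : Option ℕ → Bool} (h : τ none = false) :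
    SatClauses Φ.clauses.length Φ.ClauseHas τ ↔ Φ.Sat fun u => τ (some u) := by
  constructor
  · intro hs c hc
    obtain ⟨i, hi, rfl⟩ := List.mem_iff_getElem.1 hc
    obtain ⟨v, ⟨rfl, hn⟩ | ⟨c, hc, u, rfl, hl⟩⟩ := hs i hi
    · simp [h] at hn
    · have hc : Φ.clauses[i]? = some c := hc
      rw [List.getElem?_eq_getElem hi, Option.some.injEq] at hc
      exact ⟨_, hc ▸ hl, rfl⟩
  · intro hs i hi
    obtain ⟨⟨u, b⟩, hl, hb⟩ := hs Φ.clauses[i] (List.getElem_mem hi)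
    refine ⟨some u, .inr ⟨Φ.clauses[i], List.getElem?_eq_getElem hi, u, rfl, ?_⟩⟩
    have hb : τ (some u) = b := hb
    exact hb ▸ hl

/-- The projections that are counted. -/
def countedSet (σ : Semantics) : Set (Set (Arg (Option ℕ))) :=
  {Q | ∃ S, Φ.argFramework.IsExtension σ S ∧ top ∈ S ∧ Q = S ∩ {a | a ∈ projList Φ.data}}

theorem countedSet_subset (σ : Semantics) : Φ.countedSet σ ⊆ Set.range Φ.projSet := by
  classical
  rintro _ ⟨S, hS, -, rfl⟩
  obtain ⟨-, τ, hτ⟩ := Φ.encodes.top_mem_and_agreesOn σ hS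
  refine ⟨(fun u => τ (some u.1), decide (phi ∈ S)), (Φ.inter_projList ?_ (by simp)).symm⟩
  exact fun u b hu => hτ (some u) b (Φ.isOuter_of_mem_X hu)

/-- Projections with `phi` are always counted. The one for `x` without `phi` is counted exactly if
some `y`, with the fresh variable false, leaves no satisfying `z`. All are counted exactly if this
happens for every `x`. -/
theorem isTrue_iff (σ : Semantics) : Φ.IsTrue ↔ Φ.countedSet σ ≠ Set.range Φ.projSet := by
  classical
  constructor
  · rintro ⟨x, hx⟩ heq
    have hQ : Φ.projSet (fun u => x u, false) ∈ Φ.countedSet σ := heq ▸ ⟨_, rfl⟩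
    obtain ⟨S, hS, -, hSQ⟩ := hQ
    have hphi : phi ∉ S := fun hp => by
      have : phi ∈ Φ.projSet (fun u => x u, false) := hSQ ▸ ⟨hp, Φ.mem_projList.2 (.inl rfl)⟩
      exact Bool.false_ne_true this
    obtain ⟨-, τ, hτ⟩ := Φ.encodes.top_mem_and_agreesOn σ hS
    have href := Φ.encodes.refuted_of_phi_notMem σ hS hτ hphi
    have hτx : ∀ u ∈ Φ.X, τ (some u) = x u := by
      intro u hu
      have h1 : lit (some u) (x u) ∈ Φ.projSet (fun u => x u, false) := ⟨hu, rfl⟩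
      rw [hSQ] at h1
      exact ((hτ _ _ (Φ.isOuter_of_mem_X hu)).1 h1.1).symm
    -- Otherwise `τ` itself satisfies all clauses through the fresh literal.
    have hnone : τ none = false := by
      by_contra hn
      exact href τ (fun _ _ => rfl) (Φ.satClauses_of_none (by simpa using hn))
    obtain ⟨z, hz⟩ := hx fun u => τ (some u)
    refine href (fun v => v.elim false fun u =>
      if u ∈ Φ.X then x u else if u ∈ Φ.Y then τ (some u) else z u) ?_
      ((Φ.satClauses_iff rfl).2 hz)
    intro v hv
    rcases Φ.mem_outerVars.1 hv with rfl | ⟨u, hu, rfl⟩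
    · exact hnone.symm
    · by_cases hX : u ∈ Φ.X
      · simp [hX, hτx u hX]
      · simp [hX, hu.resolve_left hX]
  · intro hne
    by_contra hf
    apply hne
    refine (Φ.countedSet_subset σ).antisymm ?_
    rintro _ ⟨⟨x, p⟩, rfl⟩
    cases p with
    | true =>
      -- The fresh variable satisfies all clauses, so the values outside `X` are arbitrary.
      let τ : Option ℕ → Bool := fun v => v.elim true fun u =>
        if h : u ∈ Φ.X then x ⟨u, h⟩ else false
      refine ⟨Encodes.satSet Φ.IsOuter Φ.IsInner τ, Φ.encodes.satSet_isExtension (Φ.satClauses_of_none (τ := τ) rfl) σ, trivial,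
        (Φ.inter_projList (S := Encodes.satSet Φ.IsOuter Φ.IsInner τ) (x := (x, true))
          (fun u b hu => ?_) ⟨fun _ => rfl, fun _ => trivial⟩).symm⟩
      rw [Encodes.satSet_agreesOn _ b (Φ.isOuter_of_mem_X hu)]
      simp [τ, hu]
    | false =>
      simp only [IsTrue, not_exists, not_forall] at hf
      obtain ⟨y, hy⟩ := hf fun u => if h : u ∈ Φ.X then x ⟨u, h⟩ else false
      let τ : Option ℕ → Bool := fun v => v.elim false fun u =>
        if h : u ∈ Φ.X then x ⟨u, h⟩ else y u
      have href : Encodes.Refuted Φ.IsOuter Φ.clauses.length Φ.ClauseHas τ := by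
        intro τ' hτ' hs
        have hn : τ' none = false := hτ' none Φ.isOuter_none
        rw [Φ.satClauses_iff hn] at hs
        refine hy (fun u => τ' (some u)) ?_
        convert hs using 2 with u
        by_cases hX : u ∈ Φ.X
        · simp [hX, hτ' _ (Φ.isOuter_of_mem_X hX), τ]
        · by_cases hY : u ∈ Φ.Y
          · simp [hX, hY, hτ' (some u) (Φ.mem_outerVars.2 (.inr ⟨u, .inr hY, rfl⟩)), τ]
          · simp [hX, hY]
      obtain ⟨S, hS, hphi, hag⟩ := Φ.encodes.exists_extension_of_refuted href σ
      refine ⟨S, hS, (Φ.encodes.top_mem_and_agreesOn σ hS).1,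
        (Φ.inter_projList (fun u b hu => ?_) (by simp [hphi])).symm⟩
      rw [hag _ b (Φ.isOuter_of_mem_X hu)]
      simp [τ, hu]

theorem count_le (σ : Semantics) : Φ.toInput.count σ ≤ 2 ^ (Φ.X.length + 1) := by
  rw [count_toInput, ← card_projSet]
  exact Set.ncard_le_ncard (Φ.countedSet_subset σ) (Set.finite_range _)

theorem isTrue_iff_count_lt (σ : Semantics) :
    Φ.IsTrue ↔ Φ.toInput.count σ < 2 ^ (Φ.X.length + 1) := by
  rw [Φ.isTrue_iff σ, (Φ.count_le σ).lt_iff_ne, not_iff_not, count_toInput, ← card_projSet]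
  constructor
  · intro h
    exact congrArg Set.ncard h
  · intro h
    exact Set.eq_of_subset_of_ncard_le (Φ.countedSet_subset σ) h.ge (Set.finite_range _)

end QBF
end ArgTW

/-! ### A tree decomposition of the framework. -/

namespace ArgTW

open Arg

/-! ### The treewidth of the framework -/

section
variable (Φ : QBF) {ι : Type} (D : TreeDecomposition Φ.primalGraph ι)

/-- The clause number `i` is contained in a bag. -/
theorem exists_bag_clause (i : Fin Φ.clauses.length) :
    ∃ t, ∀ v : {v // v ∈ Φ.vars}, (∃ b, (v.1, b) ∈ Φ.clauses[i]) → v ∈ D.bag t := by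
  classical
  obtain ⟨t, ht⟩ := D.exists_clique_subset
    (Φ.vars.attach.filter fun v => ∃ b, (v.1, b) ∈ Φ.clauses[i]) (by
      intro u hu v hv huv
      simp only [List.mem_filter, decide_eq_true_eq] at hu hv
      exact ⟨huv, _, List.getElem_mem i.2, hu.2, hv.2⟩)
  refine ⟨t, fun v hv => ht v ?_⟩
  simp only [List.mem_filter, List.mem_attach, true_and, decide_eq_true_eq]
  exact hv

/-- The variables of a bag, with the fresh variable. -/
noncomputable def bagVars (t : ι) : Finset (Option ℕ) :=
  insert none ((D.bag t).image fun v => some v.1)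

variable {Φ} in
theorem mem_bagVars {t : ι} {v : Option ℕ} :
    v ∈ bagVars Φ D t ↔ v = none ∨ ∃ u ∈ D.bag t, v = some u.1 := by
  simp only [bagVars, Finset.mem_insert, Finset.mem_image, eq_comm]

open Classical in
/-- The arguments over the variables of a bag. -/
noncomputable def baseBag (t : ι) : Finset (Arg (Option ℕ)) :=
  ((bagVars Φ D t ×ˢ (Finset.univ : Finset Bool)).image fun p => lit p.1 p.2) ∪
    (((bagVars Φ D t ×ˢ (Finset.univ : Finset Bool)).image fun p => dl p.1 p.2) ∪
      {phi, beta, top})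

open Classical in
noncomputable def argBag (h : Fin Φ.clauses.length → ι) :
    ι ⊕ Fin Φ.clauses.length → Finset (Arg (Option ℕ))
  | .inl t => baseBag Φ D t
  | .inr i => insert (cl i) (baseBag Φ D (h i))

theorem card_baseBag_le (t : ι) : (baseBag Φ D t).card ≤ 4 * (D.bag t).card + 7 := by
  classical
  have h0 : (bagVars Φ D t).card ≤ (D.bag t).card + 1 :=
    (Finset.card_insert_le _ _).trans (Nat.add_le_add_right Finset.card_image_le 1)
  have h1 : (bagVars Φ D t ×ˢ (Finset.univ : Finset Bool)).card ≤ ((D.bag t).card + 1) * 2 := by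
    rw [Finset.card_product]
    exact Nat.mul_le_mul_right _ h0
  have h2 := Finset.card_union_le
    ((bagVars Φ D t ×ˢ (Finset.univ : Finset Bool)).image fun p => lit p.1 p.2)
    (((bagVars Φ D t ×ˢ (Finset.univ : Finset Bool)).image fun p => dl p.1 p.2) ∪
      {phi, beta, top})
  have h3 := Finset.card_union_le
    ((bagVars Φ D t ×ˢ (Finset.univ : Finset Bool)).image fun p => dl p.1 p.2)
    {phi, beta, top}
  have h4 := Finset.card_le_three (a := (phi : Arg (Option ℕ))) (b := beta) (c := top)
  have h5 := (Finset.card_image_le (s := bagVars Φ D t ×ˢ (Finset.univ : Finset Bool))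
    (f := fun p => lit p.1 p.2)).trans h1
  have h6 := (Finset.card_image_le (s := bagVars Φ D t ×ˢ (Finset.univ : Finset Bool))
    (f := fun p => dl p.1 p.2)).trans h1
  unfold baseBag
  omega

/-- At most `D.width + 2` variables, including the fresh one, with two literals and two markers
each; three constants; and possibly one clause. -/
theorem card_argBag_le [Fintype ι] (h : Fin Φ.clauses.length → ι)
    (s : ι ⊕ Fin Φ.clauses.length) : (argBag Φ D h s).card ≤ 4 * D.width + 12 := by
  classical
  rcases s with t | i
  · have h1 := card_baseBag_le Φ D t
    have h2 := D.card_bag_le t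
    simp only [argBag]
    omega
  · have h1 := card_baseBag_le Φ D (h i)
    have h2 := D.card_bag_le (h i)
    have h3 := Finset.card_insert_le (cl i) (baseBag Φ D (h i))
    simp only [argBag]
    omega

variable {Φ} in
theorem mem_baseBag {t : ι} {a : Arg (Option ℕ)} : a ∈ baseBag Φ D t ↔
    (∃ v b, v ∈ bagVars Φ D t ∧ (a = lit v b ∨ a = dl v b)) ∨ a = phi ∨ a = beta ∨ a = top := by
  simp only [baseBag, Finset.mem_union, Finset.mem_image, Finset.mem_product, Finset.mem_univ,
    and_true, Prod.exists, Finset.mem_insert, Finset.mem_singleton, ← or_assoc, and_or_left,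
    exists_or, eq_comm (a := a)]

variable {Φ} in
theorem exists_bagVars_of_isOuter_or {v : Option ℕ} (hv : Φ.IsOuter v ∨ Φ.IsInner v) :
    ∃ t, v ∈ bagVars Φ D t := by
  have key : ∀ u, u ∈ Φ.vars → ∃ t, some u ∈ bagVars Φ D t := fun u hu => by
    obtain ⟨t, ht⟩ := D.vertex_mem ⟨u, hu⟩
    exact ⟨t, (mem_bagVars D).2 (.inr ⟨_, ht, rfl⟩)⟩
  obtain ⟨t₀⟩ := D.isTree.connected.nonempty
  rcases hv with hv | hv
  · rcases Φ.mem_outerVars.1 hv with rfl | ⟨u, hu, rfl⟩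
    · exact ⟨t₀, (mem_bagVars D).2 (.inl rfl)⟩
    · exact key u (by simp only [QBF.vars, List.mem_append]; exact .inl hu)
  · obtain ⟨u, hu, rfl⟩ := Φ.mem_innerVars.1 hv
    exact key u (by simp only [QBF.vars, List.mem_append]; exact .inr hu)

variable {Φ} in
theorem exists_argBag_attack {h : Fin Φ.clauses.length → ι}
    (hh : ∀ (i : Fin Φ.clauses.length) (v : {v // v ∈ Φ.vars}),
      (∃ b, (v.1, b) ∈ Φ.clauses[i]) → v ∈ D.bag (h i))
    {a b : Arg (Option ℕ)} (hab : (a, b) ∈ attackList Φ.data) :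
    ∃ s, a ∈ argBag Φ D h s ∧ b ∈ argBag Φ D h s := by
  classical
  obtain ⟨t₀⟩ := D.isTree.connected.nonempty
  rcases Φ.mem_attackList.1 hab with ⟨v, c, hv, rfl, rfl⟩ | ⟨v, c, hv, rfl | rfl, rfl⟩ |
    ⟨v, c, hv, rfl, rfl⟩ | ⟨i, hi, rfl, rfl⟩ | ⟨i, hi, rfl, v, c, rfl, hC⟩ | ⟨rfl | rfl, rfl⟩
  · obtain ⟨t, ht⟩ := exists_bagVars_of_isOuter_or D hv
    exact ⟨.inl t, by simp [argBag, mem_baseBag, ht]⟩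
  · obtain ⟨t, ht⟩ := exists_bagVars_of_isOuter_or D (.inl hv)
    exact ⟨.inl t, by simp [argBag, mem_baseBag, ht]⟩
  · obtain ⟨t, ht⟩ := exists_bagVars_of_isOuter_or D (.inl hv)
    exact ⟨.inl t, by simp [argBag, mem_baseBag, ht]⟩
  · obtain ⟨t, ht⟩ := exists_bagVars_of_isOuter_or D (.inr hv)
    exact ⟨.inl t, by simp [argBag, mem_baseBag, ht]⟩
  · exact ⟨.inr ⟨i, hi⟩, by simp [argBag, mem_baseBag]⟩
  · have hv : v ∈ bagVars Φ D (h ⟨i, hi⟩) := by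
      rw [mem_bagVars]
      rcases hC with ⟨rfl, -⟩ | ⟨d, hd, u, rfl, hl⟩
      · exact .inl rfl
      · have hd : Φ.clauses[i]? = some d := hd
        rw [List.getElem?_eq_getElem hi, Option.some.injEq] at hd
        subst hd
        refine .inr ⟨⟨u, Φ.closed _ (List.getElem_mem hi) _ hl⟩, hh ⟨i, hi⟩ _ ⟨c, hl⟩, rfl⟩
    exact ⟨.inr ⟨i, hi⟩, by simp [argBag, mem_baseBag, hv]⟩
  · exact ⟨.inl t₀, by simp [argBag, mem_baseBag]⟩
  · exact ⟨.inl t₀, by simp [argBag, mem_baseBag]⟩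

variable {Φ} in
theorem exists_argBag_arg {h : Fin Φ.clauses.length → ι}
    {a : Arg (Option ℕ)} (ha : a ∈ argList Φ.data) : ∃ s, a ∈ argBag Φ D h s := by
  classical
  obtain ⟨t₀⟩ := D.isTree.connected.nonempty
  rcases Φ.mem_argList.1 ha with ⟨v, b, hv, rfl⟩ | ⟨v, b, hv, rfl⟩ | ⟨i, hi, rfl⟩ | rfl | rfl | rfl
  · obtain ⟨t, ht⟩ := exists_bagVars_of_isOuter_or D hv
    exact ⟨.inl t, by simp [argBag, mem_baseBag, ht]⟩
  · obtain ⟨t, ht⟩ := exists_bagVars_of_isOuter_or D (.inl hv)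
    exact ⟨.inl t, by simp [argBag, mem_baseBag, ht]⟩
  · exact ⟨.inr ⟨i, hi⟩, by simp [argBag]⟩
  · exact ⟨.inl t₀, by simp [argBag, mem_baseBag]⟩
  · exact ⟨.inl t₀, by simp [argBag, mem_baseBag]⟩
  · exact ⟨.inl t₀, by simp [argBag, mem_baseBag]⟩

variable {Φ} in
theorem exists_walk_baseBag {a : Arg (Option ℕ)} {r t : ι} (hr : a ∈ baseBag Φ D r)
    (ht : a ∈ baseBag Φ D t) : ∃ w : D.T.Walk r t, ∀ s ∈ w.support, a ∈ baseBag Φ D s := by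
  have key : ∀ v, v ∈ bagVars Φ D r → v ∈ bagVars Φ D t →
      ∃ w : D.T.Walk r t, ∀ s ∈ w.support, v ∈ bagVars Φ D s := by
    intro v hr ht
    rw [mem_bagVars] at hr ht
    obtain ⟨w⟩ := D.isTree.connected.preconnected r t
    rcases hr with rfl | ⟨u, hu, rfl⟩
    · exact ⟨w, fun s _ => (mem_bagVars D).2 (.inl rfl)⟩
    · rcases ht with ht | ⟨u', hu', he⟩
      · simp at ht
      · rw [Option.some.injEq, Subtype.val_inj] at he
        subst he
        obtain ⟨w, hw⟩ := D.exists_walk hu hu'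
        exact ⟨w, fun s hs => (mem_bagVars D).2 (.inr ⟨u, hw s hs, rfl⟩)⟩
  obtain ⟨w₀⟩ := D.isTree.connected.preconnected r t
  rcases a with (⟨v, b⟩ | ⟨v, b⟩ | i | _ | _ | _) <;> simp [mem_baseBag] at hr ht ⊢
  · exact key v hr ht
  · exact key v hr ht
  · exact ⟨w₀⟩
  · exact ⟨w₀⟩
  · exact ⟨w₀⟩

open Classical in
/-- The tree decomposition of the framework of `Φ` that belongs to a tree decomposition of `Φ` with
bags `h i` around the clauses. -/
noncomputable def frameworkDecomposition (h : Fin Φ.clauses.length → ι)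
    (hh : ∀ (i : Fin Φ.clauses.length) (v : {v // v ∈ Φ.vars}),
      (∃ b, (v.1, b) ∈ Φ.clauses[i]) → v ∈ D.bag (h i)) :
    TreeDecomposition Φ.toInput.framework.underlyingGraph (ι ⊕ Fin Φ.clauses.length) where
  T := attachLeaves D.T h
  isTree := ⟨attachLeaves_connected D.isTree.connected h,
    attachLeaves_acyclic D.isTree.isAcyclic h⟩
  bag s := Finset.univ.filter fun a => ∃ x ∈ argBag Φ D h s, x.name = a.1
  vertex_mem := by
    rintro ⟨a, ha⟩
    obtain ⟨x, hx, rfl⟩ := (Φ.isRenaming.args a).1 ha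
    obtain ⟨s, hs⟩ := exists_argBag_arg D (h := h) (List.mem_toFinset.1 hx)
    exact ⟨s, by simpa using ⟨x, hs, rfl⟩⟩
  edge_mem := by
    have key : ∀ u v : {a // a ∈ Φ.toInput.framework.args},
        (u.1, v.1) ∈ Φ.toInput.framework.attacks →
        ∃ s, (∃ x ∈ argBag Φ D h s, x.name = u.1) ∧ ∃ x ∈ argBag Φ D h s, x.name = v.1 := by
      rintro ⟨a, ha⟩ ⟨b, hb⟩ hab
      obtain ⟨x, hx, rfl⟩ := (Φ.isRenaming.args a).1 ha
      obtain ⟨y, hy, rfl⟩ := (Φ.isRenaming.args b).1 hb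
      obtain ⟨s, hs⟩ := exists_argBag_attack D hh
        (List.mem_toFinset.1 ((Φ.isRenaming.attacks x y).1 hab))
      exact ⟨s, ⟨x, hs.1, rfl⟩, y, hs.2, rfl⟩
    intro u v huv
    simp only [Finset.mem_filter, Finset.mem_univ, true_and]
    rcases ((SimpleGraph.fromRel_adj _ _ _).1 huv).2 with h1 | h1
    · exact key u v h1
    · exact (key v u h1).imp fun s hs => hs.symm
  path_inter := by
    intro r t p hp s hs a hr ht
    simp only [Finset.mem_filter, Finset.mem_univ, true_and] at hr ht ⊢
    obtain ⟨x, hxr, hx⟩ := hr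
    obtain ⟨y, hyt, hy⟩ := ht
    obtain rfl := Arg.name_injective (hx.trans hy.symm)
    refine ⟨x, forall_path_of_exists_walk (P := fun s => x ∈ argBag Φ D h s)
      (attachLeaves_acyclic D.isTree.isAcyclic h) ?_ p hp s hs, hx⟩
    -- A clause lies in its own leaf only. Any other argument occupies a connected part of the old
    -- tree and leaves whose neighbours contain it.
    by_cases hc : ∃ i : Fin Φ.clauses.length, x = cl i
    · obtain ⟨i, rfl⟩ := hc
      have : ∀ s, cl i ∈ argBag Φ D h s → s = .inr i := by
        rintro (s | j) hs
        · simp [argBag, mem_baseBag] at hs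
        · simp [argBag, mem_baseBag] at hs
          rw [Fin.ext hs]
      obtain rfl := this r hxr
      obtain rfl := this t hyt
      exact ⟨.nil, by simpa using hxr⟩
    · refine attachLeaves_walk h (P := fun s => x ∈ argBag Φ D h s)
        (fun r t hr ht => exists_walk_baseBag D hr ht) (fun i hi => ?_) r t hxr hyt
      exact (Finset.mem_insert.1 hi).resolve_left fun he => hc ⟨i, he⟩

theorem QBF.tw_toInput_le : Φ.toInput.tw ≤ 4 * Φ.tw + 11 := by
  classical
  obtain ⟨ι, _, D, hD⟩ := exists_treeDecomposition Φ.primalGraph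
  choose h hh using exists_bag_clause Φ D
  refine (treewidth_le_width (frameworkDecomposition Φ D h hh)).trans ?_
  refine TreeDecomposition.width_le _ fun s => ?_
  have h1 := card_argBag_le Φ D h s
  rw [hD] at h1
  refine le_trans ?_ h1
  rw [← Finset.card_image_of_injective _ Subtype.val_injective]
  refine le_trans (Finset.card_le_card (t := (argBag Φ D h s).image Arg.name) ?_)
    Finset.card_image_le
  intro a ha
  obtain ⟨⟨a, hargs⟩, hx, rfl⟩ := Finset.mem_image.1 ha
  simpa [frameworkDecomposition] using hx

end

end ArgTW

/-! ### The decision program and its running time. -/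

namespace ArgTW

open Coded

/-! ### Reading off the answer -/

/-- Decide whether the number with the binary digits `p.2` is below `2 ^ (|X| + 1)`. -/
def isSmallCount (p : QBFData × List Bool) : Bool :=
  (p.1.1.foldl (fun acc _ => acc.tail) p.2.tail).isEmpty

theorem foldl_tail_eq {α β : Type} (l : List α) (b : List β) :
    l.foldl (fun acc _ => acc.tail) b = b.drop l.length := by
  induction l generalizing b with
  | nil => rfl
  | cons a l ih => rw [List.foldl_cons, ih, List.drop_tail, List.length_cons]

open PolyTime in
theorem polyTime_isSmallCount : PolyTime isSmallCount := by
  have h := foldl (α := ℕ) (β := List Bool) (step := fun p => p.1.tail) (listTail.comp fst)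
    PolyBounded.id (fun b l => by
      rw [foldl_tail_eq, codeSize_pair]
      have h := codeSize_append (b.take l.length) (b.drop l.length)
      rw [List.take_append_drop] at h
      have := codeSize_pos (b.take l.length)
      omega)
  have h0 : PolyTime fun p : QBFData × List Bool => (p.2.tail, p.1.1) :=
    (listTail.comp snd).pair (fst.comp fst)
  have h1 := h.comp h0
  exact isEmpty.comp h1

/-- A number is below `2 ^ (|X| + 1)` exactly if it has at most `|X| + 1` binary digits: dropping
one digit, and one more for each variable in `X`, leaves none. -/
theorem QBF.isSmallCount_eq (Φ : QBF) (σ : Semantics) [Decidable Φ.IsTrue] :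
    isSmallCount (Φ.data, (Φ.toInput.count σ).bits) = decide Φ.IsTrue := by
  rw [Bool.eq_iff_iff, decide_eq_true_iff, Φ.isTrue_iff_count_lt σ, isSmallCount, foldl_tail_eq,
    List.drop_tail, List.isEmpty_iff, List.drop_eq_nil_iff, Nat.size_eq_bits_len, Nat.size_le]
  rfl

theorem QBF.codeSize_count_le (Φ : QBF) (σ : Semantics) :
    codeSize (Φ.toInput.count σ).bits ≤ 4 * Φ.size + 9 := by
  have h1 : (Φ.toInput.count σ).bits.length ≤ Φ.X.length + 2 := by
    rw [Nat.size_eq_bits_len, Nat.size_le]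
    exact (Φ.count_le σ).trans_lt (Nat.pow_lt_pow_right (by omega) (by omega))
  have h2 : Φ.X.length < Φ.size :=
    (length_lt_codeSize Φ.X).trans_le (by
      change codeSize Φ.X ≤ codeSize Φ.data
      rw [QBF.data, codeSize_pair]
      omega)
  have h3 := codeSize_le_of_forall (l := (Φ.toInput.count σ).bits) (M := 3)
    fun b _ => by cases b <;> simp [codeSize, code, encBool, Data.size]
  omega

/-! ### The decision procedure -/

/-- A program for the counting problem yields a program for quantified formulas that is slower by a
polynomial. -/
theorem exists_decision_prog (σ : Semantics) (p : Prog) : ∃ (P : Prog) (a : ℕ),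
    ∀ (Φ : QBF) (t : ℕ), p.Outputs Φ.toInput.enc (encNat (Φ.toInput.count σ)) t →
      ∃ t' ≤ t + (Φ.size + 2) ^ a,
        P.Outputs Φ.enc (encBool (open Classical in decide Φ.IsTrue)) t' := by
  classical
  obtain ⟨b, -, hR⟩ := polyTime_reduction
  obtain ⟨c, -, hQ⟩ := polyTime_isSmallCount
  set N := p.bound + 1 with hN
  obtain ⟨R, hR⟩ := hR (N + 1)
  obtain ⟨Q, hQ⟩ := hQ N
  obtain ⟨a, ha⟩ : PolyBounded fun n => (n + 2) ^ b + (5 * n + 10 + 2) ^ c + 5 :=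
    ((PolyBounded.pow b).add (PolyBounded.comp_pow c
      (((PolyBounded.const 5).mul .id).add (.const 10)))).add (.const 5)
  -- Register `N` keeps the formula for the final test, and the instance is built in `N + 1`. Both
  -- are out of reach of `p`, which works on register `0` and others below `N`.
  refine ⟨.seq (.copy N 0) (.seq (.copy (N + 1) 0) (.seq R (.seq (.copy 0 (N + 1)) (.seq p
    (.seq (.cons N N 0) (.seq Q (.copy 0 N))))))), a, fun Φ t ht => ?_⟩
  obtain ⟨sp, ep, op⟩ := ht
  set s₀ : Store := Function.update (fun _ => Data.nil) 0 Φ.enc with hs₀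
  set s₁ := Function.update s₀ N (s₀ 0) with hs₁
  set s₂ := Function.update s₁ (N + 1) (s₁ 0) with hs₂
  have h2 : s₂ (N + 1) = code Φ.data := by
    simp [hs₂, hs₁, hs₀, hN, QBF.enc_eq]
  obtain ⟨s₃, tR, eR, oR, kR, lR⟩ := hR s₂ Φ.data h2
  set s₄ := Function.update s₃ 0 (s₃ (N + 1)) with hs₄
  have h4 : ∀ m < N, s₄ m = Function.update (fun _ => Data.nil) 0 Φ.toInput.enc m := by
    intro m hm
    by_cases h0 : m = 0
    · simp [hs₄, h0, oR, QBF.enc_toInput]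
    · rw [hs₄, Function.update_of_ne h0, Function.update_of_ne h0, kR m (by omega), hs₂,
        Function.update_of_ne (by omega), hs₁, Function.update_of_ne (by omega), hs₀,
        Function.update_of_ne h0]
  obtain ⟨s₅, e₅, lo₅, hi₅⟩ := ep.frame (n := N) (by omega) h4
  set s₆ := Function.update s₅ N (.cons (s₅ N) (s₅ 0)) with hs₆
  have h6 : s₆ N = code (Φ.data, (Φ.toInput.count σ).bits) := by
    have h7 : s₅ N = Φ.enc := by
      rw [hi₅ N le_rfl, hs₄, Function.update_of_ne (by omega), kR N (by omega), hs₂,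
        Function.update_of_ne (by omega), hs₁]
      simp [hs₀]
    rw [hs₆, Function.update_self, h7, lo₅ 0 (by omega), op]
    rfl
  obtain ⟨s₇, tQ, eQ, oQ, -, lQ⟩ := hQ s₆ _ h6
  refine ⟨_, ?_, _, .seq (.copy _ _ s₀) (.seq (.copy _ _ s₁) (.seq eR (.seq (.copy _ _ s₃) (.seq e₅
    (.seq (.cons _ _ _ s₅) (.seq eQ (.copy 0 N s₇))))))), ?_⟩
  · have h8 : codeSize (Φ.data, (Φ.toInput.count σ).bits) ≤ 5 * Φ.size + 10 := by
      have := Φ.codeSize_count_le σ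
      have h9 : codeSize Φ.data = Φ.size := rfl
      rw [codeSize_pair, h9]
      omega
    have h9 := Nat.pow_le_pow_left (Nat.add_le_add_right h8 2) c
    have h10 := ha Φ.size
    have h11 : tR ≤ (Φ.size + 2) ^ b := lR
    dsimp only at h10 lQ
    omega
  · rw [Function.update_self, oQ, Φ.isSmallCount_eq σ]
    rfl

theorem QBF.exists_frameworkSize_le : ∃ c, ∀ Φ : QBF,
    Φ.toInput.frameworkSize ≤ (Φ.size + 2) ^ c := by
  obtain ⟨c, hc, -⟩ := polyTime_reduction
  refine ⟨c, fun Φ => le_trans ?_ (hc Φ.data)⟩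
  have h : codeSize (reduction Φ.data) = Φ.toInput.enc.size := by rw [Φ.enc_toInput]; rfl
  rw [h, PCredInput.enc, Data.size, PCredInput.frameworkSize]
  omega

/-! ### Running times -/

/-- The treewidth of the instance can be any number up to `4 * k + 11` and `f` need not be monotone,
so `F` is a running maximum. The finitely many small arguments contribute a constant to it. -/
theorem exists_isLittleO_bound {f : ℕ → ℝ}
    (hf : f =o[Filter.atTop] fun k : ℕ => (k : ℝ)) : ∃ F : ℕ → ℝ,
      F =o[Filter.atTop] (fun k : ℕ => (k : ℝ)) ∧ (∀ k, 0 ≤ F k) ∧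
        ∀ k, ∀ j ≤ 4 * k + 11, f j ≤ F k := by
  let F : ℕ → ℝ := fun k => (Finset.range (4 * k + 12)).sup' ⟨0, by simp⟩ fun j => |f j|
  have hF : ∀ k, ∀ j ≤ 4 * k + 11, |f j| ≤ F k := fun k j hj =>
    Finset.le_sup' (fun j => |f j|) (Finset.mem_range.2 (by omega))
  have hF0 : ∀ k, 0 ≤ F k := fun k => (abs_nonneg _).trans (hF k 0 (by omega))
  refine ⟨F, ?_, hF0, fun k j hj => (le_abs_self _).trans (hF k j hj)⟩
  rw [Asymptotics.isLittleO_iff] at hf ⊢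
  intro ε hε
  -- The constant `15` comes from `4 * k + 11 ≤ 15 * k` for `k ≥ 1`.
  obtain ⟨K, hK⟩ := Filter.eventually_atTop.1 (hf (c := ε / 15) (by positivity))
  obtain ⟨M, hM⟩ := ((Finset.range K).image fun j => |f j|).exists_le
  rw [Finset.forall_mem_image] at hM
  obtain ⟨L, hL⟩ := exists_nat_ge (M / ε)
  filter_upwards [Filter.eventually_ge_atTop (max L 1)] with k hk
  rw [Real.norm_of_nonneg (hF0 k), Real.norm_of_nonneg (Nat.cast_nonneg k)]
  refine Finset.sup'_le _ _ fun j hj => ?_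
  rw [Finset.mem_range] at hj
  by_cases hjK : j < K
  · refine (hM (Finset.mem_range.2 hjK)).trans ?_
    have h1 : (L : ℝ) ≤ k := by exact_mod_cast (le_max_left _ _).trans hk
    rw [div_le_iff₀ hε] at hL
    nlinarith
  · have h1 := hK j (by omega)
    rw [Real.norm_eq_abs, Real.norm_of_nonneg (Nat.cast_nonneg j)] at h1
    have h2 : (j : ℝ) ≤ 15 * k := by
      have := (le_max_right L 1).trans hk
      exact_mod_cast (by omega : j ≤ 15 * k)
    calc |f j| ≤ ε / 15 * j := h1
      _ ≤ ε / 15 * (15 * k) := by gcongr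
      _ = ε * k := by ring

theorem one_le_tripleExp (x : ℝ) : 1 ≤ (2 : ℝ) ^ ((2 : ℝ) ^ ((2 : ℝ) ^ x)) :=
  Real.one_le_rpow (by norm_num) (by positivity)

theorem tripleExp_mono {x y : ℝ} (h : x ≤ y) :
    (2 : ℝ) ^ ((2 : ℝ) ^ ((2 : ℝ) ^ x)) ≤ (2 : ℝ) ^ ((2 : ℝ) ^ ((2 : ℝ) ^ y)) := by
  gcongr <;> norm_num

theorem natCast_add_two_pow_le {n : ℕ} (hn : 2 ≤ n) (c : ℕ) :
    ((n + 2 : ℕ) : ℝ) ^ c ≤ (n : ℝ) ^ (2 * c : ℝ) := by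
  have h1 : n + 2 ≤ n ^ 2 := by nlinarith
  have h2 : (n : ℝ) ^ (2 * c : ℝ) = ((n ^ 2 : ℕ) : ℝ) ^ c := by
    rw [show (2 * c : ℝ) = ((2 * c : ℕ) : ℝ) by push_cast; ring, Real.rpow_natCast, pow_mul]
    push_cast
    rfl
  rw [h2]
  gcongr

/-- For `n ≥ 2` one has `n + 2 ≤ n ^ 2`, so polynomial factors become powers of `n` with doubled
exponents. The sum is at most twice the product of factors that are at least `1`, and this `2` is
absorbed by one more factor `n`; hence the `+ 1` in the exponent. -/
theorem tripleExp_bound {n n' a c : ℕ} {x y z w t : ℝ} (hn : 2 ≤ n) (hn' : 1 ≤ n')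
    (hc : n' ≤ (n + 2) ^ c) (hxy : x ≤ y) (hzw : z ≤ w) (hw : 0 ≤ w)
    (ht : t ≤ (2 : ℝ) ^ ((2 : ℝ) ^ ((2 : ℝ) ^ x)) * (n' : ℝ) ^ z) :
    t + ((n + 2 : ℕ) : ℝ) ^ a ≤
      (2 : ℝ) ^ ((2 : ℝ) ^ ((2 : ℝ) ^ y)) * (n : ℝ) ^ (2 * c * w + (2 * a + 1)) := by
  have hn0 : (2 : ℝ) ≤ n := by exact_mod_cast hn
  have hn1 : (1 : ℝ) ≤ n := by linarith
  have hnpos : (0 : ℝ) < n := by linarith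
  have hn'1 : (1 : ℝ) ≤ n' := by exact_mod_cast hn'
  have h1 : (n' : ℝ) ^ z ≤ (n : ℝ) ^ (2 * c * w : ℝ) := by
    calc (n' : ℝ) ^ z ≤ (n' : ℝ) ^ w := Real.rpow_le_rpow_of_exponent_le hn'1 hzw
      _ ≤ ((n : ℝ) ^ (2 * c : ℝ)) ^ w := by
        refine Real.rpow_le_rpow (by linarith) ?_ hw
        refine le_trans ?_ (natCast_add_two_pow_le hn c)
        exact_mod_cast hc
      _ = (n : ℝ) ^ (2 * c * w : ℝ) := (Real.rpow_mul hnpos.le _ _).symm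
  have h2 := natCast_add_two_pow_le hn a
  set E := (2 : ℝ) ^ ((2 : ℝ) ^ ((2 : ℝ) ^ y)) with hE
  have hE1 : 1 ≤ E := one_le_tripleExp y
  set A := (n : ℝ) ^ (2 * c * w : ℝ)
  set B := (n : ℝ) ^ (2 * a : ℝ)
  have hA : 1 ≤ A := Real.one_le_rpow hn1 (by positivity)
  have hB : 1 ≤ B := Real.one_le_rpow hn1 (by positivity)
  have h3 : t ≤ E * A := ht.trans (mul_le_mul (tripleExp_mono hxy) h1
    (Real.rpow_nonneg (by linarith) _) (by linarith))
  have hEA : 1 ≤ E * A := one_le_mul_of_one_le_of_one_le hE1 hA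
  rw [Real.rpow_add hnpos, Real.rpow_add hnpos, Real.rpow_one]
  calc t + ((n + 2 : ℕ) : ℝ) ^ a ≤ E * A + B := add_le_add h3 h2
    _ ≤ E * A * B + E * A * B :=
      add_le_add (le_mul_of_one_le_right (by linarith) hB) (le_mul_of_one_le_left (by linarith) hEA)
    _ = E * A * B * 2 := by ring
    _ ≤ E * A * B * n := by gcongr
    _ = E * (A * (B * n)) := by ring

theorem qbf_solvable_of_pcred_solvable {σ : Semantics} (h : PCredSolvableInTripleExpTime σ) :
    SolvableInTripleExpTime QBF.enc (fun Φ => encBool (open Classical in decide Φ.IsTrue))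
      QBF.tw QBF.size := by
  obtain ⟨p, f, g, hf, hg, hp⟩ := h
  obtain ⟨F, hF, -, hfF⟩ := exists_isLittleO_bound hf
  obtain ⟨G, hG, hG0, hgG⟩ := exists_isLittleO_bound hg
  obtain ⟨P, a, hP⟩ := exists_decision_prog σ p
  obtain ⟨c, hc⟩ := QBF.exists_frameworkSize_le
  refine ⟨P, F, fun k => 2 * c * G k + (2 * a + 1), hF, ?_, fun Φ => ?_⟩
  -- The degree `2 * a + 1` of the polynomial overhead is a constant, hence `o(k)`.
  · refine (hG.const_mul_left _).add (Asymptotics.isLittleO_const_left.2 (.inr ?_))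
    exact tendsto_norm_atTop_atTop.comp tendsto_natCast_atTop_atTop
  · obtain ⟨t, ho, ht⟩ := hp Φ.toInput
    obtain ⟨t', ht', ho'⟩ := hP Φ t ho
    refine ⟨t', ho', ?_⟩
    have h1 : 2 ≤ Φ.size := by
      have := Data.size_pos (encList encNat Φ.X)
      simp only [QBF.size, QBF.enc, Data.size]
      omega
    have h2 : (t' : ℝ) ≤ t + ((Φ.size + 2 : ℕ) : ℝ) ^ a := by exact_mod_cast ht'
    exact h2.trans (tripleExp_bound h1 (Data.size_pos _) (hc Φ) (hfF _ _ Φ.tw_toInput_le)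
      (hgG _ _ Φ.tw_toInput_le) (hG0 _) ht)

end ArgTW

theorem mainTheorem5 (h3ETH : ArgTW.ThreeETH) (σ : ArgTW.Semantics) :
    ¬ ArgTW.PCredSolvableInTripleExpTime σ :=
  fun h => h3ETH (ArgTW.qbf_solvable_of_pcred_solvable h)
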